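/- **Setting.** Let $h>0$ and $t_k=kh$, $k\in\mathbb N=\{0,1,2,\dots\}$. Consider the sampled-data plant $$\dot x=A_cx+B_cw_c+B_{cu}u,\quad x(t_k^+)=A_dx(t_k)+B_dw_d[k]+B_{du}\hat u[k],$$ $$z_c=C_cx+D_{cc}w_c+D_{cu}u,\quad z_d[k]=C_dx(t_k)+D_{dd}w_d[k]+D_{du}\hat u[k],\quad y[k]=C_yx(t_k)+D_{yd}w_d[k]$$ for $t\in(t_k,t_{k+1}]$, with the generalized hold $\dot x^h=A^h_cx^h$, $x^h(t_k^+)=A^h_dx^h(t_k)+B^h\hat u[k]$, $u=C^hx^h$. All signals are finite-dimensional and real, and states are left-continuous. With $x^p=(x,x^h)\in\mathbb R^{n_p}$ put $$A^p_c=\begin{bmatrix}A_c&B_{cu}C^h\\0&A^h_c\end{bmatrix},\ B^p_c=\begin{bmatrix}B_c\\0\end{bmatrix},\ A^p_d=\begin{bmatrix}A_d&0\\0&A^h_d\end{bmatrix},\ B^p_d=\begin{bmatrix}B_d\\0\end{bmatrix},\ B^p_u=\begin{bmatrix}B_{du}\\B^h\end{bmatrix},$$ $$C^p_c=[\,C_c\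 \ D_{cu}C^h\,],\ D^p_{cc}=D_{cc},\ C^p_d=[\,C_d\ \ 0\,],\ D^p_{dd}=D_{dd},\ D^p_{du}=D_{du},\ C^p_y=[\,C_y\ \ 0\,],\ D^p_{yd}=D_{yd}.$$ The discrete-time controller $x^c(t_k^+)=A^cx^c(t_k)+B^cy[k]$, $\hat u[k]=C^cx^c(t_k)+D^cy[k]$, with $x^c\in\mathbb R^{n_p}$ constant on each $(t_k,t_{k+1}]$, gives with $\xi=(x^p,x^c)$ the closed loop $$\dot\xi=\mathcal A_c\xi+\mathcal B_cw_c,\quad \xi(t_k^+)=\mathcal A_d\xi(t_k)+\mathcal B_dw_d[k],\quad z_c=\mathcal C_c\xi+\mathcal D_cw_c,\quad z_d[k]=\mathcal C_d\xi(t_k)+\mathcal D_dw_d[k],$$ $$\mathcal A_c=\begin{bmatrix}A^p_c&0\\0&0\end{bmatrix},\quad \mathcal B_c=\begin{bmatrix}B^p_c\\0\end{bmatrix},\quad \mathcal C_c=[\,C^p_c\ \ 0\,],\quad \mathcal D_c=D^p_{cc},$$ $$\mathcal A_d=\begin{bmatrix}A^p_d+B^p_uD^cC^p_y&B^p_uC^c\\B^cC^p_y&A^c\end{bmatrix},\quad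 \mathcal B_d=\begin{bmatrix}B^p_d+B^p_uD^cD^p_{yd}\\B^cD^p_{yd}\end{bmatrix},$$ $$\mathcal C_d=[\,C^p_d+D^p_{du}D^cC^p_y\ \ D^p_{du}C^c\,],\quad \mathcal D_d=D^p_{dd}+D^p_{du}D^cD^p_{yd}.$$ **Supply functions.** Let $s_i(w,z)=\begin{bmatrix}w\\z\end{bmatrix}^\top\begin{bmatrix}Q_i&S_i\\S_i^\top&R_i\end{bmatrix}\begin{bmatrix}w\\z\end{bmatrix}$ for $i\in\{c,d\}$, where $R_c\preceq0$ and $R_d=-E_d^\top\Pi_d^{-1}E_d$ for some matrices $E_d$ and $\Pi_d\succ0$. (Matrices called positive or negative (semi)definite are understood to be symmetric.) **Dissipativity and stability.** The closed loop is *dissipative* with respect to $s_c,s_d$ if there is a storage function $S:\mathbb R^{2n_p}\times\mathbb R_{\ge0}\to\mathbb R_{\ge0}$ with $$S(\xi(t_1),t_1)\le S(\xi(t_0),t_0)+\int_{t_0}^{t_1}s_c(w_c,z_c)\,dt+\sum_{k:\ t_0\le kh<t_1}s_d(w_d[k],z_d[k])$$ for all $0\le t_0\le t_1$ along all trajectories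 for which $w_c,z_c$ are essentially bounded and $w_d,z_d$ are bounded. Its origin is *globally exponentially stable* (GES) if there are $c,\alpha>0$ such that $\|\xi(t)\|\le ce^{-\alpha t}\|\xi(0)\|$ for all $t\ge0$ and all solutions with $w_c=0$, $w_d=0$. **Hamiltonian.** Put $M_1=\mathcal C_c^\top R_c\mathcal C_c$, $M_2=Q_c+S_c\mathcal D_c+\mathcal D_c^\top S_c^\top+\mathcal D_c^\top R_c\mathcal D_c$, $M_3=\mathcal C_c^\top S_c^\top+\mathcal C_c^\top R_c\mathcal D_c$, $$H=\begin{bmatrix}\mathcal A_c-\mathcal B_cM_2^{-1}M_3^\top&\mathcal B_cM_2^{-1}\mathcal B_c^\top\\M_1-M_3M_2^{-1}M_3^\top&-(\mathcal A_c-\mathcal B_cM_2^{-1}M_3^\top)^\top\end{bmatrix},\qquad F(\tau)=e^{-H\tau}=\begin{bmatrix}F_{11}(\tau)&F_{12}(\tau)\\F_{21}(\tau)&F_{22}(\tau)\end{bmatrix}.$$ Assume that $M_2\succ0$ and that $F_{11}(t)$ is invertible for all $t\in[0,h]$. Let $\bar A\in\mathbb R^{n_p\times n_p}$ be the upper left block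 of $F_{11}(h)^{-1}$, and let $\bar B,\bar C$ be matrices such that $\hat B=\begin{bmatrix}\bar B\\0\end{bmatrix}$ and $\hat C=[\,\bar C\ \ 0\,]$ satisfy $\hat B\hat B^\top=-F_{11}(h)^{-1}F_{12}(h)$ and $\hat C^\top\hat C=F_{21}(h)F_{11}(h)^{-1}$. **Theorem.** Suppose that there are matrices $\Gamma,\Theta,\Upsilon,\Omega,X,Y$ with $$\begin{bmatrix} Y&\star&\star&\star&\star&\star&\star&\star\\ I&X&\star&\star&\star&\star&\star&\star\\ S_d\Omega_c&S_dK_2&Z&\star&\star&\star&\star&\star\\ E_d\Omega_c&E_dK_2&E_d\Omega_d&\Pi_d&\star&\star&\star&\star\\ \bar C\Omega_a&\bar CK_1&\bar C\Omega_b&0&I&\star&\star&\star\\ L_1&\Gamma&L_2&0&0&Y&\star&\star\\ \bar A\Omega_a&\bar AK_1&\bar A\Omega_b&0&0&I&X&\star\\ 0&0&0&0&0&\bar B^\top Y&\bar B^\top&I \end{bmatrix}\succ0,$$ where each $\star$ is the transpose of the block in the mirrored position and $$\begin{bmatrix}\Omega_a&\Omega_b\\\Omega_c&\Omega_d\end{bmatrix}=\begin{bmatrix}A^p_d&B^p_d\\C^p_d&D^p_{dd}\end{bmatrix}+\begin{bmatrix}B^p_u\\D^p_{du}\end{bmatrix}\Omega\,[\,C^p_y\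 \ D^p_{yd}\,],\qquad\begin{bmatrix}K_1\\K_2\end{bmatrix}=\begin{bmatrix}A^p_d&B^p_u\\C^p_d&D^p_{du}\end{bmatrix}\begin{bmatrix}X\\\Upsilon\end{bmatrix},$$ $$[\,L_1\ \ L_2\,]=[\,Y\ \ \Theta\,]\begin{bmatrix}\bar AA^p_d&\bar AB^p_d\\C^p_y&D^p_{yd}\end{bmatrix},\qquad Z=Q_d+S_d\Omega_d+\Omega_d^\top S_d^\top.$$ Then there are nonsingular $U,V\in\mathbb R^{n_p\times n_p}$ with $UV^\top=I-XY$, and for any such $U,V$ the controller $$\begin{bmatrix}A^c&B^c\\C^c&D^c\end{bmatrix}=\begin{bmatrix}V&Y\bar AB^p_u\\0&I\end{bmatrix}^{-1}\begin{bmatrix}\Gamma-Y\bar AA^p_dX&\Theta\\\Upsilon&\Omega\end{bmatrix}\begin{bmatrix}U^\top&0\\C^p_yX&I\end{bmatrix}^{-1}$$ renders the closed loop dissipative with respect to $s_c,s_d$ and its origin GES. -/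

import Mathlib

open Matrix MeasureTheory Set

/-! ## Data: plant, hold device, controller -/

/-- The sampled-data plant
`ẋ = Ac x + Bc wc + Bcu u`, `x(tₖ⁺) = Ad x(tₖ) + Bd wd[k] + Bdu û[k]`,
`zc = Cc x + Dcc wc + Dcu u`, `zd[k] = Cd x(tₖ) + Ddd wd[k] + Ddu û[k]`,
`y[k] = Cy x(tₖ) + Dyd wd[k]` (there is no feedthrough from `û` to `y`).
The type parameters index the coordinates of the respective signals. -/
structure SDPlant (x wc wd zc zd u y : Type*) where
  Ac : Matrix x x ℝ
  Bc : Matrix x wc ℝ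
  Bcu : Matrix x u ℝ
  Ad : Matrix x x ℝ
  Bd : Matrix x wd ℝ
  Bdu : Matrix x u ℝ
  Cc : Matrix zc x ℝ
  Dcc : Matrix zc wc ℝ
  Dcu : Matrix zc u ℝ
  Cd : Matrix zd x ℝ
  Ddd : Matrix zd wd ℝ
  Ddu : Matrix zd u ℝ
  Cy : Matrix y x ℝ
  Dyd : Matrix y wd ℝ

/-- The generalized hold device `ẋʰ = Ac xʰ`, `xʰ(tₖ⁺) = Ad xʰ(tₖ) + B û[k]`, `u = C xʰ`. -/
structure HoldDevice (xh u : Type*) where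
  Ac : Matrix xh xh ℝ
  Ad : Matrix xh xh ℝ
  B : Matrix xh u ℝ
  C : Matrix u xh ℝ

/-- The discrete-time controller `ẋᶜ = 0`, `xᶜ(tₖ⁺) = A xᶜ(tₖ) + B y[k]`,
`û[k] = C xᶜ(tₖ) + D y[k]`. -/
structure DTController (xc u y : Type*) where
  A : Matrix xc xc ℝ
  B : Matrix xc y ℝ
  C : Matrix u xc ℝ
  D : Matrix u y ℝ

/-- The controller read off from its block matrix `[A B; C D]`. -/
def DTController.ofBlockMatrix {xc u y : Type*} (M : Matrix (xc ⊕ u) (xc ⊕ y) ℝ) :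
    DTController xc u y where
  A := M.toBlocks₁₁
  B := M.toBlocks₁₂
  C := M.toBlocks₂₁
  D := M.toBlocks₂₂

/-- The generalized plant (plant combined with hold device), with discrete input `û`:
`ẋᵖ = Ac xᵖ + Bc wc`, `xᵖ(tₖ⁺) = Ad xᵖ(tₖ) + Bd wd[k] + Bu û[k]`, `zc = Cc xᵖ + Dcc wc`,
`zd[k] = Cd xᵖ(tₖ) + Ddd wd[k] + Ddu û[k]`, `y[k] = Cy xᵖ(tₖ) + Dyd wd[k]`. -/
structure GenPlant (xp wc wd zc zd u y : Type*) where
  Ac : Matrix xp xp ℝ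
  Bc : Matrix xp wc ℝ
  Ad : Matrix xp xp ℝ
  Bd : Matrix xp wd ℝ
  Bu : Matrix xp u ℝ
  Cc : Matrix zc xp ℝ
  Dcc : Matrix zc wc ℝ
  Cd : Matrix zd xp ℝ
  Ddd : Matrix zd wd ℝ
  Ddu : Matrix zd u ℝ
  Cy : Matrix y xp ℝ
  Dyd : Matrix y wd ℝ

/-- Combination of plant and hold device, with state `xᵖ = (x, xʰ)`. -/
def SDPlant.withHold {x xh wc wd zc zd u y : Type*} [Fintype u]
    (P : SDPlant x wc wd zc zd u y) (K : HoldDevice xh u) :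
    GenPlant (x ⊕ xh) wc wd zc zd u y where
  Ac := fromBlocks P.Ac (P.Bcu * K.C) 0 K.Ac
  Bc := fromRows P.Bc 0
  Ad := fromBlocks P.Ad 0 0 K.Ad
  Bd := fromRows P.Bd 0
  Bu := fromRows P.Bdu K.B
  Cc := fromCols P.Cc (P.Dcu * K.C)
  Dcc := P.Dcc
  Cd := fromCols P.Cd 0
  Ddd := P.Ddd
  Ddu := P.Ddu
  Cy := fromCols P.Cy 0
  Dyd := P.Dyd

/-! ## Linear periodic jump-flow systems -/

/-- The flow part `ξ̇ = Ac ξ + Bc wc`, `zc = Cc ξ + Dc wc`. -/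
structure FlowSystem (n wc zc : Type*) where
  Ac : Matrix n n ℝ
  Bc : Matrix n wc ℝ
  Cc : Matrix zc n ℝ
  Dc : Matrix zc wc ℝ

/-- A linear periodic jump-flow system: flow part, together with the jump part
`ξ(tₖ⁺) = Ad ξ(tₖ) + Bd wd[k]`, `zd[k] = Cd ξ(tₖ) + Dd wd[k]`. -/
structure LPJF (n wc wd zc zd : Type*) extends FlowSystem n wc zc where
  Ad : Matrix n n ℝ
  Bd : Matrix n wd ℝ
  Cd : Matrix zd n ℝ
  Dd : Matrix zd wd ℝ

/-- The flow part of the closed loop, with state `ξ = (xᵖ, xᶜ)`. As the controller state is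
constant during flow, it depends on the controller only through the state dimension. -/
def GenPlant.closedLoopFlow {xp wc wd zc zd u y : Type*} (P : GenPlant xp wc wd zc zd u y)
    (xc : Type*) : FlowSystem (xp ⊕ xc) wc zc where
  Ac := fromBlocks P.Ac 0 0 0
  Bc := fromRows P.Bc 0
  Cc := fromCols P.Cc 0
  Dc := P.Dcc

/-- The closed loop of a generalized plant and a controller, with state `ξ = (xᵖ, xᶜ)`. -/
def GenPlant.closedLoop {xp xc wc wd zc zd u y : Type*} [Fintype u] [Fintype y]
    (P : GenPlant xp wc wd zc zd u y) (K : DTController xc u y) :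
    LPJF (xp ⊕ xc) wc wd zc zd where
  toFlowSystem := P.closedLoopFlow xc
  Ad := fromBlocks (P.Ad + P.Bu * K.D * P.Cy) (P.Bu * K.C) (K.B * P.Cy) K.A
  Bd := fromRows (P.Bd + P.Bu * K.D * P.Dyd) (K.B * P.Dyd)
  Cd := fromCols (P.Cd + P.Ddu * K.D * P.Cy) (P.Ddu * K.C)
  Dd := P.Ddd + P.Ddu * K.D * P.Dyd

/-- `(ξ, wc, wd, zc, zd)` is a trajectory on `[0, ∞)` of the jump-flow system with jump times
`tₖ = k h`. The state is left-continuous: `ξ (k h)` is its value before the `k`-th jump, and on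
`(tₖ, tₖ₊₁]` it is the (Carathéodory) solution of the flow equation that starts from
`ξ(tₖ⁺) = Ad ξ(tₖ) + Bd wd[k]`. -/
structure LPJF.IsTrajectory {n wc wd zc zd : Type*} [Fintype n] [Fintype wc] [Fintype wd]
    (T : LPJF n wc wd zc zd) (h : ℝ)
    (ξ : ℝ → n → ℝ) (w : ℝ → wc → ℝ) (v : ℕ → wd → ℝ) (z : ℝ → zc → ℝ) (ζ : ℕ → zd → ℝ) :
    Prop where
  intervalIntegrable : ∀ k : ℕ,
    IntervalIntegrable (fun s => T.Ac *ᵥ ξ s + T.Bc *ᵥ w s) volume (k * h) ((k + 1) * h)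
  flow : ∀ k : ℕ, ∀ t ∈ Ioc (k * h) ((k + 1) * h),
    ξ t = (T.Ad *ᵥ ξ (k * h) + T.Bd *ᵥ v k) + ∫ s in (k * h)..t, (T.Ac *ᵥ ξ s + T.Bc *ᵥ w s)
  flowOutput : ∀ t > 0, z t = T.Cc *ᵥ ξ t + T.Dc *ᵥ w t
  jumpOutput : ∀ k : ℕ, ζ k = T.Cd *ᵥ ξ (k * h) + T.Dd *ᵥ v k

/-- The quadratic supply function `[w; z]ᵀ [Q S; Sᵀ R] [w; z]`. -/
def quadSupply {w z : Type*} [Fintype w] [Fintype z]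
    (Q : Matrix w w ℝ) (S : Matrix w z ℝ) (R : Matrix z z ℝ) (a : w → ℝ) (b : z → ℝ) : ℝ :=
  Sum.elim a b ⬝ᵥ (fromBlocks Q S Sᵀ R *ᵥ Sum.elim a b)

/-- Dissipativity with respect to the flow supply function `sc` and the jump supply function `sd`:
there is a nonnegative storage function `S` such that the dissipation inequality holds between any
two times `0 ≤ t₀ ≤ t₁`, along all trajectories with essentially bounded signals. The sum runs over the jumps
with `t₀ ≤ k h < t₁`, that is, from the least natural number `k ≥ t₀ / h` up to the greatest
natural number `k < t₁ / h`. -/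
def LPJF.IsDissipative {n wc wd zc zd : Type*} [Fintype n] [Fintype wc] [Fintype wd]
    [Fintype zc] [Fintype zd] (T : LPJF n wc wd zc zd) (h : ℝ)
    (sc : (wc → ℝ) → (zc → ℝ) → ℝ) (sd : (wd → ℝ) → (zd → ℝ) → ℝ) : Prop :=
  ∃ S : (n → ℝ) → ℝ → ℝ, (∀ ξ t, 0 ≤ t → 0 ≤ S ξ t) ∧ ∀ ξ w v z ζ, T.IsTrajectory h ξ w v z ζ →
    MemLp w ⊤ (volume.restrict (Ici 0)) → MemLp z ⊤ (volume.restrict (Ici 0)) →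
    (∃ c, ∀ k, ‖v k‖ ≤ c) → (∃ c, ∀ k, ‖ζ k‖ ≤ c) →
    ∀ t₀ t₁ : ℝ, 0 ≤ t₀ → t₀ ≤ t₁ →
      S (ξ t₁) t₁ ≤ S (ξ t₀) t₀ + (∫ t in t₀..t₁, sc (w t) (z t))
        + ∑ k ∈ Finset.Ico ⌈t₀ / h⌉₊ ⌈t₁ / h⌉₊, sd (v k) (ζ k)

/-- Global exponential stability of the origin: all solutions of the undisturbed system satisfy
`‖ξ(t)‖ ≤ c exp(-α t) ‖ξ(0)‖`, in the Euclidean norm `‖a‖ = √(aᵀ a)`. -/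
def LPJF.IsGES {n wc wd zc zd : Type*} [Fintype n] [Fintype wc] [Fintype wd]
    (T : LPJF n wc wd zc zd) (h : ℝ) : Prop :=
  ∃ c > 0, ∃ α > 0, ∀ ξ z ζ, T.IsTrajectory h ξ 0 0 z ζ → ∀ t ≥ 0,
    √(ξ t ⬝ᵥ ξ t) ≤ c * Real.exp (-α * t) * √(ξ 0 ⬝ᵥ ξ 0)

/-! ## The Hamiltonian matrix of the flow -/

namespace FlowSystem

variable {n wc zc : Type*} [Fintype n] [DecidableEq n] [Fintype wc] [DecidableEq wc] [Fintype zc]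
  (T : FlowSystem n wc zc) (Q : Matrix wc wc ℝ) (S : Matrix wc zc ℝ) (R : Matrix zc zc ℝ)

/-- `M₁ = Ccᵀ R Cc`. -/
def M₁ : Matrix n n ℝ := T.Ccᵀ * R * T.Cc

/-- `M₂ = Q + S Dc + Dcᵀ Sᵀ + Dcᵀ R Dc`. -/
def M₂ : Matrix wc wc ℝ := Q + S * T.Dc + T.Dcᵀ * Sᵀ + T.Dcᵀ * R * T.Dc

/-- `M₃ = Ccᵀ Sᵀ + Ccᵀ R Dc`. -/
def M₃ : Matrix n wc ℝ := T.Ccᵀ * Sᵀ + T.Ccᵀ * R * T.Dc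

/-- The Hamiltonian matrix `H`. -/
noncomputable def hamiltonian : Matrix (n ⊕ n) (n ⊕ n) ℝ :=
  fromBlocks
    (T.Ac - T.Bc * (T.M₂ Q S R)⁻¹ * (T.M₃ S R)ᵀ)
    (T.Bc * (T.M₂ Q S R)⁻¹ * T.Bcᵀ)
    (T.M₁ R - T.M₃ S R * (T.M₂ Q S R)⁻¹ * (T.M₃ S R)ᵀ)
    (-(T.Ac - T.Bc * (T.M₂ Q S R)⁻¹ * (T.M₃ S R)ᵀ)ᵀ)

/-- `F(τ) = exp(-H τ)`. -/
noncomputable def F (τ : ℝ) : Matrix (n ⊕ n) (n ⊕ n) ℝ :=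
  NormedSpace.exp (-(τ • T.hamiltonian Q S R))

/-- The block `F₁₁(τ)`. -/
noncomputable def F₁₁ (τ : ℝ) : Matrix n n ℝ := (T.F Q S R τ).toBlocks₁₁

/-- The block `F₁₂(τ)`. -/
noncomputable def F₁₂ (τ : ℝ) : Matrix n n ℝ := (T.F Q S R τ).toBlocks₁₂

/-- The block `F₂₁(τ)`. -/
noncomputable def F₂₁ (τ : ℝ) : Matrix n n ℝ := (T.F Q S R τ).toBlocks₂₁

end FlowSystem

/-! ## The synthesis LMI and the controller formula -/

/-- The symmetric completion `[A Bᵀ; B D]` of a lower block triangle. -/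
def starBlock {m n : Type*} (A : Matrix m m ℝ) (B : Matrix n m ℝ) (D : Matrix n n ℝ) :
    Matrix (m ⊕ n) (m ⊕ n) ℝ :=
  fromBlocks A Bᵀ B D

/-- `row ⧺ A` appends the block `A` at the right of a block row. -/
local infixl:60 " ⧺ " => Matrix.fromCols

section Synthesis

variable {xp wc wd zc zd u y q b c : Type*} [Fintype xp] [DecidableEq xp] [Fintype wd]
  [DecidableEq wd] [Fintype zd] [Fintype u] [DecidableEq u] [Fintype y] [DecidableEq y]
  [DecidableEq b] [DecidableEq c]

/-- The `8 × 8` block matrix of the synthesis LMI. The blocks above the diagonal are the transposes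
of those below; the matrix is built by adding one block row (left of the diagonal block) and the
diagonal block at a time. -/
def synthesisMatrix (P : GenPlant xp wc wd zc zd u y)
    (Qd : Matrix wd wd ℝ) (Sd : Matrix wd zd ℝ) (Ed : Matrix q zd ℝ) (Pid : Matrix q q ℝ)
    (Abar : Matrix xp xp ℝ) (Bbar : Matrix xp b ℝ) (Cbar : Matrix c xp ℝ)
    (Γ : Matrix xp xp ℝ) (Θ : Matrix xp y ℝ) (Υ : Matrix u xp ℝ) (Ω : Matrix u y ℝ)
    (X Y : Matrix xp xp ℝ) :
    Matrix (((((((xp ⊕ xp) ⊕ wd) ⊕ q) ⊕ c) ⊕ xp) ⊕ xp) ⊕ b)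
      (((((((xp ⊕ xp) ⊕ wd) ⊕ q) ⊕ c) ⊕ xp) ⊕ xp) ⊕ b) ℝ :=
  let Ωa := P.Ad + P.Bu * Ω * P.Cy
  let Ωb := P.Bd + P.Bu * Ω * P.Dyd
  let Ωc := P.Cd + P.Ddu * Ω * P.Cy
  let Ωd := P.Ddd + P.Ddu * Ω * P.Dyd
  let K₁ := P.Ad * X + P.Bu * Υ
  let K₂ := P.Cd * X + P.Ddu * Υ
  let L₁ := Y * Abar * P.Ad + Θ * P.Cy
  let L₂ := Y * Abar * P.Bd + Θ * P.Dyd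
  let Z := Qd + Sd * Ωd + Ωdᵀ * Sdᵀ
  let N₂ := starBlock Y 1 X
  let N₃ := starBlock N₂ (Sd * Ωc ⧺ Sd * K₂) Z
  let N₄ := starBlock N₃ (Ed * Ωc ⧺ Ed * K₂ ⧺ Ed * Ωd) Pid
  let N₅ := starBlock N₄ (Cbar * Ωa ⧺ Cbar * K₁ ⧺ Cbar * Ωb ⧺ 0) 1
  let N₆ := starBlock N₅ (L₁ ⧺ Γ ⧺ L₂ ⧺ 0 ⧺ 0) Y
  let N₇ := starBlock N₆ (Abar * Ωa ⧺ Abar * K₁ ⧺ Abar * Ωb ⧺ 0 ⧺ 0 ⧺ 1) X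
  starBlock N₇ (0 ⧺ 0 ⧺ 0 ⧺ 0 ⧺ 0 ⧺ Bbarᵀ * Y ⧺ Bbarᵀ) 1

/-- The controller given by the explicit formula
`[Aᶜ Bᶜ; Cᶜ Dᶜ] = [V, Y Ā Bu; 0, I]⁻¹ [Γ - Y Ā Ad X, Θ; Υ, Ω] [Uᵀ, 0; Cy X, I]⁻¹`. -/
noncomputable def synthesisController (P : GenPlant xp wc wd zc zd u y) (Abar : Matrix xp xp ℝ)
    (Γ : Matrix xp xp ℝ) (Θ : Matrix xp y ℝ) (Υ : Matrix u xp ℝ) (Ω : Matrix u y ℝ)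
    (X Y U V : Matrix xp xp ℝ) : DTController xp u y :=
  DTController.ofBlockMatrix
    ((fromBlocks V (Y * Abar * P.Bu) 0 1)⁻¹
      * fromBlocks (Γ - Y * Abar * P.Ad * X) Θ Υ Ω
      * (fromBlocks Uᵀ 0 (P.Cy * X) 1)⁻¹)

end Synthesis

set_option linter.unusedSectionVars false

/-! ## Calculus of matrix-valued curves -/

section MatrixCalculus

open scoped Matrix.Norms.Operator

variable {m n : Type*} [Fintype m] [Fintype n]

/-! The storage function is a quadratic form `ξᵀ P(τ) ξ`, where `τ` is the time left until the next
jump and `P` solves the Riccati equation `P' = P A + Aᵀ P + P G P - N` whose coefficients are the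
blocks of the Hamiltonian `H`. Along a flow, completing the square in the disturbance shows that the
storage grows by at most the integral of the supply (`riccati_completeSquare`, `storage_flow_le`).

With `P(0) = P₀`, the Riccati solution is explicit in terms of `F = exp (-τ H)`: `P(τ) = F₂₁ F₁₁⁻¹ +
F₁₁⁻ᵀ (P₀⁻¹ + F₁₁⁻¹ F₁₂)⁻¹ F₁₁⁻¹`. Since `F` is symplectic, `F₂₁ F₁₁⁻¹` and `-F₁₁⁻¹ F₁₂` are
symmetric and increase from `0`. Hence the single condition that `P₀⁻¹ + F₁₁(h)⁻¹ F₁₂(h)` be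
positive definite makes `P` well defined and positive definite on all of `[0, h]`. At `τ = h` the
factorizations by `B̂` and `Ĉ` turn it into `ĈᵀĈ + Âᵀ (P₀⁻¹ - B̂B̂ᵀ)⁻¹ Â`, with `Â = F₁₁(h)⁻¹ =
diag(Ā, I)` because the controller state does not flow.

What remains is the condition at `τ = h` and a strict inequality for one jump, from `P(h)` after the
jump to `P₀` before it. Both are Schur complements of one analysis inequality
(`posDef_inv_sub_of_forall_pos`, `jump_lt_of_forall_pos`). The synthesis LMI is this inequality
after a congruence: `P₀` is chosen with `P₀ [I X; 0 Uᵀ] = [Y I; Vᵀ 0]`, and substituting `[I X; 0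
Uᵀ]` for the state and for the multiplier of the post-jump state makes the controller enter only
through `Γ, Θ, Υ, Ω` (`exists_storage_of_synthesis`).

Summing flows and jumps gives dissipativity. For zero disturbances both supplies are nonpositive, as
`R_c` and `R_d` are; strictness of the jump inequality and compactness then give a contraction by a
fixed factor in every period, hence exponential stability. -/

theorem HasDerivAt.matrix_linearMap {p q : Type*} [Fintype p] [Fintype q] {F : ℝ → Matrix m n ℝ}
    {F' : Matrix m n ℝ} {t : ℝ} (hF : HasDerivAt F F' t) (L : Matrix m n ℝ →ₗ[ℝ] Matrix p q ℝ) :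
    HasDerivAt (fun s => L (F s)) (L F') t :=
  (LinearMap.toContinuousLinearMap L).hasFDerivAt.comp_hasDerivAt t hF

theorem HasDerivAt.matrix_toBlocks₁₁ {F : ℝ → Matrix (n ⊕ n) (n ⊕ n) ℝ}
    {F' : Matrix (n ⊕ n) (n ⊕ n) ℝ} {t : ℝ} (hF : HasDerivAt F F' t) :
    HasDerivAt (fun s => (F s).toBlocks₁₁) F'.toBlocks₁₁ t :=
  hF.matrix_linearMap
    { toFun := toBlocks₁₁, map_add' := fun _ _ => rfl, map_smul' := fun _ _ => rfl }

theorem HasDerivAt.matrix_toBlocks₁₂ {F : ℝ → Matrix (n ⊕ n) (n ⊕ n) ℝ}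
    {F' : Matrix (n ⊕ n) (n ⊕ n) ℝ} {t : ℝ} (hF : HasDerivAt F F' t) :
    HasDerivAt (fun s => (F s).toBlocks₁₂) F'.toBlocks₁₂ t :=
  hF.matrix_linearMap
    { toFun := toBlocks₁₂, map_add' := fun _ _ => rfl, map_smul' := fun _ _ => rfl }

theorem HasDerivAt.matrix_toBlocks₂₁ {F : ℝ → Matrix (n ⊕ n) (n ⊕ n) ℝ}
    {F' : Matrix (n ⊕ n) (n ⊕ n) ℝ} {t : ℝ} (hF : HasDerivAt F F' t) :
    HasDerivAt (fun s => (F s).toBlocks₂₁) F'.toBlocks₂₁ t :=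
  hF.matrix_linearMap
    { toFun := toBlocks₂₁, map_add' := fun _ _ => rfl, map_smul' := fun _ _ => rfl }

theorem HasDerivAt.matrix_transpose {F : ℝ → Matrix m n ℝ} {F' : Matrix m n ℝ} {t : ℝ}
    (hF : HasDerivAt F F' t) : HasDerivAt (fun s => (F s)ᵀ) F'ᵀ t :=
  hF.matrix_linearMap (Matrix.transposeLinearEquiv m n ℝ ℝ).toLinearMap

theorem HasDerivAt.matrix_inv [DecidableEq n] {F : ℝ → Matrix n n ℝ} {F' : Matrix n n ℝ} {t : ℝ}
    (hF : HasDerivAt F F' t) (hu : IsUnit (F t)) :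
    HasDerivAt (fun s => (F s)⁻¹) (-((F t)⁻¹ * F' * (F t)⁻¹)) t := by
  obtain ⟨v, hv⟩ := hu
  have h1 := hasFDerivAt_ringInverse (𝕜 := ℝ) v
  rw [hv] at h1
  have h2 := h1.comp_hasDerivAt t hF
  have h3 : (fun s => (F s)⁻¹) = Ring.inverse ∘ F := by
    funext s
    simp [Matrix.nonsing_inv_eq_ringInverse]
  rw [h3]
  convert! h2 using 1
  have h4 : ((v⁻¹ : (Matrix n n ℝ)ˣ) : Matrix n n ℝ) = (F t)⁻¹ := by
    rw [← hv, Matrix.coe_units_inv]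
  simp [h4]

theorem HasDerivAt.matrix_quadForm {F : ℝ → Matrix n n ℝ} {F' : Matrix n n ℝ} {t : ℝ}
    (hF : HasDerivAt F F' t) (a b : n → ℝ) :
    HasDerivAt (fun s => a ⬝ᵥ F s *ᵥ b) (a ⬝ᵥ F' *ᵥ b) t :=
  (LinearMap.toContinuousLinearMap
    ({ toFun := fun M => a ⬝ᵥ M *ᵥ b
       map_add' := fun M N => by simp [add_mulVec, dotProduct_add]
       map_smul' := fun r M => by simp [smul_mulVec, dotProduct_smul] } :
      Matrix n n ℝ →ₗ[ℝ] ℝ)).hasFDerivAt.comp_hasDerivAt t hF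

end MatrixCalculus

/-! ## Hamiltonian matrices and the Riccati equation -/

section Riccati

open scoped Matrix.Norms.Operator

variable {n : Type*} [Fintype n] [DecidableEq n] (A G N : Matrix n n ℝ)

/-- The Hamiltonian matrix with upper blocks `A`, `G` and lower left block `N`. -/
def hamMatrix {n : Type*} (A G N : Matrix n n ℝ) : Matrix (n ⊕ n) (n ⊕ n) ℝ :=
  fromBlocks A G N (-Aᵀ)

/-- The curve `τ ↦ exp (-τ H)`, where `H` is the Hamiltonian matrix of `A`, `G`, `N`. -/
noncomputable def hamExp (τ : ℝ) : Matrix (n ⊕ n) (n ⊕ n) ℝ :=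
  NormedSpace.exp (-(τ • hamMatrix A G N))

@[simp] theorem hamExp_zero : hamExp A G N 0 = 1 := by
  simp [hamExp]

/-- `H` commutes with its exponential, so the derivative can be written with `H` on the left or, in
the next lemma, on the right. Both are needed: for `F₂₁ F₁₁⁻¹` the left form yields the Riccati
equation, the right form a derivative of visible sign. -/
theorem hasDerivAt_hamExp (τ : ℝ) :
    HasDerivAt (hamExp A G N) (-(hamMatrix A G N * hamExp A G N τ)) τ := by
  have h1 := hasDerivAt_exp_smul_const' (𝕂 := ℝ) (-hamMatrix A G N) τ
  simpa [hamExp, Function.comp_def] using! h1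

theorem hasDerivAt_hamExp' (τ : ℝ) :
    HasDerivAt (hamExp A G N) (-(hamExp A G N τ * hamMatrix A G N)) τ := by
  have h1 := hasDerivAt_exp_smul_const (𝕂 := ℝ) (-hamMatrix A G N) τ
  simpa [hamExp, Function.comp_def] using! h1

theorem eq_const_of_hasDerivAt_zero {E : Type*} [NormedAddCommGroup E] [NormedSpace ℝ E]
    {f : ℝ → E} (hf : ∀ t, HasDerivAt f 0 t) (t : ℝ) : f t = f 0 :=
  is_const_of_deriv_eq_zero (fun s => (hf s).differentiableAt) (fun s => (hf s).deriv) t 0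

theorem hamExp_mul_of_hamMatrix_mul_eq_zero {E : Matrix (n ⊕ n) (n ⊕ n) ℝ}
    (hE : hamMatrix A G N * E = 0) (τ : ℝ) : hamExp A G N τ * E = E := by
  have h1 : ∀ t, HasDerivAt (fun s => hamExp A G N s * E) 0 t := fun t => by
    have := (hasDerivAt_hamExp' A G N t).mul_const E
    rwa [neg_mul, mul_assoc, hE, mul_zero, neg_zero] at this
  simpa using eq_const_of_hasDerivAt_zero h1 τ

theorem mul_hamExp_of_mul_hamMatrix_eq_zero {E : Matrix (n ⊕ n) (n ⊕ n) ℝ}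
    (hE : E * hamMatrix A G N = 0) (τ : ℝ) : E * hamExp A G N τ = E := by
  have h1 : ∀ t, HasDerivAt (fun s => E * hamExp A G N s) 0 t := fun t => by
    have := (hasDerivAt_hamExp A G N t).const_mul E
    rwa [mul_neg, ← mul_assoc, hE, zero_mul, neg_zero] at this
  simpa using eq_const_of_hasDerivAt_zero h1 τ

variable {A G N}

/-- `FᵀJF` is conserved because `HᵀJ + JH = 0`, and it equals `J` at time `0`. -/
theorem hamExp_mem_symplecticGroup (hG : Gᵀ = G) (hN : Nᵀ = N) (τ : ℝ) :
    hamExp A G N τ ∈ symplecticGroup n ℝ := by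
  rw [SymplecticGroup.mem_iff']
  have hH : (hamMatrix A G N)ᵀ * J n ℝ + J n ℝ * hamMatrix A G N = 0 := by
    simp [hamMatrix, J, fromBlocks_transpose, fromBlocks_multiply, hG, hN, fromBlocks_add]
  have h1 : ∀ t, HasDerivAt (fun s => (hamExp A G N s)ᵀ * J n ℝ * hamExp A G N s) 0 t := fun t => by
    have h2 := ((hasDerivAt_hamExp A G N t).matrix_transpose.mul_const (J n ℝ)).mul
      (hasDerivAt_hamExp A G N t)
    convert! h2 using 1
    have h3 := congrArg (fun M => -((hamExp A G N t)ᵀ * M * hamExp A G N t)) hH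
    simp only [mul_zero, zero_mul, neg_zero] at h3
    rw [← h3, transpose_neg, transpose_mul]
    noncomm_ring
  simpa using eq_const_of_hasDerivAt_zero h1 τ

variable (A G N) in
/-- `-F₁₁⁻¹ F₁₂`. -/
noncomputable def reachGramian (τ : ℝ) : Matrix n n ℝ :=
  -((hamExp A G N τ).toBlocks₁₁⁻¹ * (hamExp A G N τ).toBlocks₁₂)

variable (A G N) in
/-- `F₂₁ F₁₁⁻¹`. -/
noncomputable def costGramian (τ : ℝ) : Matrix n n ℝ :=
  (hamExp A G N τ).toBlocks₂₁ * (hamExp A G N τ).toBlocks₁₁⁻¹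

variable (A G N) in
/-- `F₁₁⁻¹`. -/
noncomputable def invTransition (τ : ℝ) : Matrix n n ℝ :=
  (hamExp A G N τ).toBlocks₁₁⁻¹

theorem hasDerivAt_invTransition {τ : ℝ} (hu : IsUnit (hamExp A G N τ).toBlocks₁₁) :
    HasDerivAt (invTransition A G N) (invTransition A G N τ * A
      + invTransition A G N τ * G * costGramian A G N τ) τ := by
  have h1 := (hasDerivAt_hamExp A G N τ).matrix_toBlocks₁₁.matrix_inv hu
  have hdet := (Matrix.isUnit_iff_isUnit_det _).1 hu
  unfold invTransition costGramian
  convert! h1 using 1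
  generalize hamExp A G N τ = F at *
  rw [← fromBlocks_toBlocks F] at hdet ⊢
  simp only [hamMatrix, fromBlocks_multiply, fromBlocks_neg, toBlocks_fromBlocks₁₁,
    toBlocks_fromBlocks₂₁] at hdet ⊢
  simp only [neg_mul, neg_neg, mul_add, add_mul, mul_assoc, mul_neg,
    Matrix.mul_nonsing_inv _ hdet, mul_one]

theorem hasDerivAt_costGramian {τ : ℝ} (hu : IsUnit (hamExp A G N τ).toBlocks₁₁) :
    HasDerivAt (costGramian A G N) (costGramian A G N τ * A + Aᵀ * costGramian A G N τ
      + costGramian A G N τ * G * costGramian A G N τ - N) τ := by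
  have h1 := (hasDerivAt_hamExp A G N τ).matrix_toBlocks₂₁.mul (hasDerivAt_invTransition hu)
  have hdet := (Matrix.isUnit_iff_isUnit_det _).1 hu
  unfold invTransition costGramian at *
  convert! h1 using 1
  generalize hamExp A G N τ = F at *
  rw [← fromBlocks_toBlocks F] at hdet ⊢
  simp only [hamMatrix, fromBlocks_multiply, fromBlocks_neg, toBlocks_fromBlocks₁₁,
    toBlocks_fromBlocks₂₁] at hdet ⊢
  simp only [neg_mul, neg_neg, mul_add, add_mul, mul_assoc, neg_add,
    Matrix.mul_nonsing_inv _ hdet, mul_one]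
  abel

/-- For a symplectic matrix the Schur complement `F₂₂ - F₂₁ F₁₁⁻¹ F₁₂` is the inverse transpose of
`F₁₁`. This identity puts the derivatives of both Gramians into the congruence form that shows their
sign. -/
theorem toBlocks₂₂_sub (hG : Gᵀ = G) (hN : Nᵀ = N) {τ : ℝ}
    (hu : IsUnit (hamExp A G N τ).toBlocks₁₁) :
    (hamExp A G N τ).toBlocks₂₂ + costGramian A G N τ * -(hamExp A G N τ).toBlocks₁₂
      = (invTransition A G N τ)ᵀ := by
  have h1 := hamExp_mem_symplecticGroup (A := A) hG hN τ
  have hdet := (Matrix.isUnit_iff_isUnit_det _).1 hu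
  have hdet' : IsUnit (hamExp A G N τ).toBlocks₁₁ᵀ.det := by rwa [det_transpose]
  unfold costGramian invTransition
  rw [transpose_nonsing_inv]
  generalize hamExp A G N τ = F at *
  rw [← fromBlocks_toBlocks F, SymplecticGroup.fromBlocks_mem_iff] at h1
  obtain ⟨h2, -, h4⟩ := h1
  refine (Matrix.inv_eq_right_inv ?_).symm
  rw [mul_add, ← mul_assoc, ← mul_assoc, h2, mul_assoc F.toBlocks₂₁ᵀ,
    Matrix.mul_nonsing_inv _ hdet, mul_one, mul_neg, ← sub_eq_add_neg, h4]

theorem hasDerivAt_costGramian' (hG : Gᵀ = G) (hN : Nᵀ = N) {τ : ℝ}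
    (hu : IsUnit (hamExp A G N τ).toBlocks₁₁) :
    HasDerivAt (costGramian A G N)
      (-((invTransition A G N τ)ᵀ * N * invTransition A G N τ)) τ := by
  have h0 := (hasDerivAt_hamExp' A G N τ).matrix_toBlocks₁₁.matrix_inv hu
  have h1 := (hasDerivAt_hamExp' A G N τ).matrix_toBlocks₂₁.mul h0
  have hdet := (Matrix.isUnit_iff_isUnit_det _).1 hu
  rw [← toBlocks₂₂_sub hG hN hu]
  unfold invTransition costGramian at *
  convert! h1 using 1
  generalize hamExp A G N τ = F at *
  rw [← fromBlocks_toBlocks F] at hdet ⊢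
  simp only [hamMatrix, fromBlocks_multiply, fromBlocks_neg, toBlocks_fromBlocks₁₁,
    toBlocks_fromBlocks₂₁, toBlocks_fromBlocks₂₂, toBlocks_fromBlocks₁₂] at hdet ⊢
  simp only [mul_neg, neg_mul, neg_neg, mul_add, add_mul, mul_assoc, neg_add,
    Matrix.nonsing_inv_mul_cancel_left _ _ hdet]
  abel

theorem hasDerivAt_reachGramian (hG : Gᵀ = G) (hN : Nᵀ = N) {τ : ℝ}
    (hu : IsUnit (hamExp A G N τ).toBlocks₁₁) :
    HasDerivAt (reachGramian A G N)
      (invTransition A G N τ * G * (invTransition A G N τ)ᵀ) τ := by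
  have h1 := ((hasDerivAt_invTransition hu).mul
    (hasDerivAt_hamExp A G N τ).matrix_toBlocks₁₂).neg
  have hdet := (Matrix.isUnit_iff_isUnit_det _).1 hu
  rw [← toBlocks₂₂_sub hG hN hu]
  unfold invTransition reachGramian costGramian at *
  convert! h1 using 1
  generalize hamExp A G N τ = F at *
  rw [← fromBlocks_toBlocks F] at hdet ⊢
  simp only [hamMatrix, fromBlocks_multiply, fromBlocks_neg, toBlocks_fromBlocks₁₁,
    toBlocks_fromBlocks₂₁, toBlocks_fromBlocks₂₂, toBlocks_fromBlocks₁₂] at hdet ⊢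
  simp only [mul_neg, neg_neg, mul_add, add_mul, mul_assoc, neg_add]
  abel

theorem costGramian_transpose (hG : Gᵀ = G) (hN : Nᵀ = N) {τ : ℝ}
    (hu : IsUnit (hamExp A G N τ).toBlocks₁₁) :
    (costGramian A G N τ)ᵀ = costGramian A G N τ := by
  have h1 := hamExp_mem_symplecticGroup (A := A) hG hN τ
  have hdet := (Matrix.isUnit_iff_isUnit_det _).1 hu
  have hdet' : IsUnit (hamExp A G N τ).toBlocks₁₁ᵀ.det := by rwa [det_transpose]
  unfold costGramian
  generalize hamExp A G N τ = F at *
  rw [← fromBlocks_toBlocks F, SymplecticGroup.fromBlocks_mem_iff] at h1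
  obtain ⟨h2, -, -⟩ := h1
  rw [transpose_mul, transpose_nonsing_inv]
  calc F.toBlocks₁₁ᵀ⁻¹ * F.toBlocks₂₁ᵀ
      = F.toBlocks₁₁ᵀ⁻¹ * (F.toBlocks₂₁ᵀ * F.toBlocks₁₁) * F.toBlocks₁₁⁻¹ := by
        rw [mul_assoc, mul_assoc, Matrix.mul_nonsing_inv _ hdet, mul_one]
    _ = _ := by
        rw [← h2, ← mul_assoc, Matrix.nonsing_inv_mul _ hdet', one_mul]

theorem reachGramian_transpose (hG : Gᵀ = G) (hN : Nᵀ = N) {τ : ℝ}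
    (hu : IsUnit (hamExp A G N τ).toBlocks₁₁) :
    (reachGramian A G N τ)ᵀ = reachGramian A G N τ := by
  have h1 := SymplecticGroup.transpose_mem (hamExp_mem_symplecticGroup (A := A) hG hN τ)
  have hdet := (Matrix.isUnit_iff_isUnit_det _).1 hu
  have hdet' : IsUnit (hamExp A G N τ).toBlocks₁₁ᵀ.det := by rwa [det_transpose]
  unfold reachGramian
  generalize hamExp A G N τ = F at *
  rw [← fromBlocks_toBlocks F, fromBlocks_transpose, SymplecticGroup.fromBlocks_mem_iff] at h1
  obtain ⟨h2, -, -⟩ := h1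
  simp only [transpose_transpose] at h2
  rw [transpose_neg, transpose_mul, transpose_nonsing_inv]
  congr 1
  calc F.toBlocks₁₂ᵀ * F.toBlocks₁₁ᵀ⁻¹
      = F.toBlocks₁₁⁻¹ * (F.toBlocks₁₁ * F.toBlocks₁₂ᵀ) * F.toBlocks₁₁ᵀ⁻¹ := by
        rw [← mul_assoc, Matrix.nonsing_inv_mul _ hdet, one_mul]
    _ = _ := by
        rw [h2, mul_assoc, mul_assoc, Matrix.mul_nonsing_inv _ hdet', mul_one]

@[simp] theorem costGramian_zero : costGramian A G N 0 = 0 := by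
  simp [costGramian, ← fromBlocks_one]

@[simp] theorem reachGramian_zero : reachGramian A G N 0 = 0 := by
  simp [reachGramian, ← fromBlocks_one]

@[simp] theorem invTransition_zero : invTransition A G N 0 = 1 := by
  simp [invTransition, ← fromBlocks_one]

end Riccati

/-! ### Monotonicity of the Gramians and positivity of the Riccati solution -/

section Riccati

open scoped Matrix.Norms.Operator

variable {n : Type*} [Fintype n] [DecidableEq n] {A G N : Matrix n n ℝ}

theorem Matrix.PosSemidef.quadForm_nonneg {n : Type*} [Fintype n] {M : Matrix n n ℝ}
    (hM : M.PosSemidef) (v : n → ℝ) : 0 ≤ v ⬝ᵥ M *ᵥ v := by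
  simpa using hM.dotProduct_mulVec_nonneg v

theorem Matrix.PosDef.quadForm_pos {n : Type*} [Fintype n] {M : Matrix n n ℝ}
    (hM : M.PosDef) {v : n → ℝ} (hv : v ≠ 0) : 0 < v ⬝ᵥ M *ᵥ v := by
  simpa using hM.dotProduct_mulVec_pos hv

theorem Matrix.PosDef.transpose_eq {n : Type*} {M : Matrix n n ℝ}
    (hM : M.PosDef) : Mᵀ = M := by
  simpa using hM.isHermitian.eq

theorem Matrix.PosSemidef.transpose_eq {n : Type*} {M : Matrix n n ℝ}
    (hM : M.PosSemidef) : Mᵀ = M := by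
  simpa using hM.isHermitian.eq

/-- The derivative is a congruence of `-N ⪰ 0` and the value at time `0` is `0`. -/
theorem costGramian_posSemidef (hG : Gᵀ = G) (hN : (-N).PosSemidef) {h : ℝ}
    (hu : ∀ t ∈ Icc 0 h, IsUnit (hamExp A G N t).toBlocks₁₁) {τ : ℝ} (hτ : τ ∈ Icc 0 h) :
    (costGramian A G N τ).PosSemidef := by
  have hN' : Nᵀ = N := by simpa using hN.transpose_eq
  refine .of_dotProduct_mulVec_nonneg
    (by simpa [Matrix.IsHermitian] using costGramian_transpose hG hN' (hu τ hτ)) fun v => ?_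
  have hd : ∀ t ∈ Icc 0 h, HasDerivAt (fun s => v ⬝ᵥ costGramian A G N s *ᵥ v)
      (v ⬝ᵥ (-((invTransition A G N t)ᵀ * N * invTransition A G N t)) *ᵥ v) t :=
    fun t ht => (hasDerivAt_costGramian' hG hN' (hu t ht)).matrix_quadForm v v
  have hmono : MonotoneOn (fun s => v ⬝ᵥ costGramian A G N s *ᵥ v) (Icc 0 h) := by
    refine monotoneOn_of_deriv_nonneg (convex_Icc _ _)
      (fun t ht => (hd t ht).continuousAt.continuousWithinAt)
      (fun t ht => (hd t (interior_subset ht)).differentiableAt.differentiableWithinAt)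
      (fun t ht => ?_)
    rw [(hd t (interior_subset ht)).deriv]
    have := (hN.conjTranspose_mul_mul_same (invTransition A G N t)).quadForm_nonneg v
    simpa using this
  have h0 : (0 : ℝ) ∈ Icc 0 h := ⟨le_rfl, hτ.1.trans hτ.2⟩
  simpa using hmono h0 hτ hτ.1

theorem reachGramian_quadForm_mono (hG : G.PosSemidef) (hN : Nᵀ = N) {h : ℝ}
    (hu : ∀ t ∈ Icc 0 h, IsUnit (hamExp A G N t).toBlocks₁₁) (v : n → ℝ) :
    MonotoneOn (fun s => v ⬝ᵥ reachGramian A G N s *ᵥ v) (Icc 0 h) := by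
  have hd : ∀ t ∈ Icc 0 h, HasDerivAt (fun s => v ⬝ᵥ reachGramian A G N s *ᵥ v)
      (v ⬝ᵥ (invTransition A G N t * G * (invTransition A G N t)ᵀ) *ᵥ v) t :=
    fun t ht => (hasDerivAt_reachGramian hG.transpose_eq hN (hu t ht)).matrix_quadForm v v
  refine monotoneOn_of_deriv_nonneg (convex_Icc _ _)
    (fun t ht => (hd t ht).continuousAt.continuousWithinAt)
    (fun t ht => (hd t (interior_subset ht)).differentiableAt.differentiableWithinAt)
    (fun t ht => ?_)
  rw [(hd t (interior_subset ht)).deriv]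
  have := (hG.mul_mul_conjTranspose_same (invTransition A G N t)).quadForm_nonneg v
  simpa using this

/-- The subtracted Gramian increases with `τ`, so `τ = h` is the worst case. -/
theorem posDef_sub_reachGramian (hG : G.PosSemidef) (hN : Nᵀ = N) {h : ℝ}
    (hu : ∀ t ∈ Icc 0 h, IsUnit (hamExp A G N t).toBlocks₁₁) {M : Matrix n n ℝ}
    (hM : (M - reachGramian A G N h).PosDef) {τ : ℝ} (hτ : τ ∈ Icc 0 h) :
    (M - reachGramian A G N τ).PosDef := by
  have hh : h ∈ Icc 0 h := ⟨hτ.1.trans hτ.2, le_rfl⟩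
  have hMt : Mᵀ = M := by
    have := hM.transpose_eq
    rwa [transpose_sub, reachGramian_transpose hG.transpose_eq hN (hu h hh), sub_left_inj] at this
  refine .of_dotProduct_mulVec_pos ?_ fun v hv => ?_
  · simp [Matrix.IsHermitian, hMt, reachGramian_transpose hG.transpose_eq hN (hu τ hτ)]
  · have h1 := hM.quadForm_pos hv
    have h2 := reachGramian_quadForm_mono hG hN hu v hτ hh hτ.2
    simp only [sub_mulVec, dotProduct_sub, star_trivial] at h1 h2 ⊢
    linarith

variable (A G N) in
/-- The solution, with initial value `Q⁻¹` at time `0`, of the Riccati equation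
`P' = P A + Aᵀ P + P G P - N`. -/
noncomputable def riccatiSol (Q : Matrix n n ℝ) (τ : ℝ) : Matrix n n ℝ :=
  costGramian A G N τ
    + (invTransition A G N τ)ᵀ * (Q - reachGramian A G N τ)⁻¹ * invTransition A G N τ

theorem riccatiSol_zero (Q : Matrix n n ℝ) : riccatiSol A G N Q 0 = Q⁻¹ := by
  simp [riccatiSol]

/-- Write the solution as `K + Φᵀ W Φ`. Here `K` solves the same equation with initial value `0`,
`Φ' = Φ (A + G K)`, and `W = (Q - reachGramian)⁻¹` has `W' = W Φ G Φᵀ W`, which supplies the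
quadratic term. -/
theorem hasDerivAt_riccatiSol (hG : Gᵀ = G) (hN : Nᵀ = N) {Q : Matrix n n ℝ} {τ : ℝ}
    (hu : IsUnit (hamExp A G N τ).toBlocks₁₁) (hQ : IsUnit (Q - reachGramian A G N τ)) :
    HasDerivAt (riccatiSol A G N Q)
      (riccatiSol A G N Q τ * A + Aᵀ * riccatiSol A G N Q τ
        + riccatiSol A G N Q τ * G * riccatiSol A G N Q τ - N) τ := by
  have h1 := (hasDerivAt_costGramian hu).add
    (((hasDerivAt_invTransition hu).matrix_transpose.mul
      (((hasDerivAt_reachGramian hG hN hu).const_sub Q).matrix_inv hQ)).mul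
      (hasDerivAt_invTransition hu))
  convert! h1 using 1
  have hK := costGramian_transpose (A := A) hG hN hu
  unfold riccatiSol
  simp only [transpose_add, transpose_mul, hG, hK, Pi.mul_apply]
  noncomm_ring

theorem riccatiSol_posDef (hG : G.PosSemidef) (hN : (-N).PosSemidef) {h : ℝ}
    (hu : ∀ t ∈ Icc 0 h, IsUnit (hamExp A G N t).toBlocks₁₁) {Q : Matrix n n ℝ}
    (hQ : (Q - reachGramian A G N h).PosDef) {τ : ℝ} (hτ : τ ∈ Icc 0 h) :
    (riccatiSol A G N Q τ).PosDef := by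
  have hN' : Nᵀ = N := by simpa using hN.transpose_eq
  refine PosDef.posSemidef_add (costGramian_posSemidef hG.transpose_eq hN hu hτ) ?_
  have := (posDef_sub_reachGramian hG hN' hu hQ hτ).inv.conjTranspose_mul_mul_same
    (B := invTransition A G N τ) ?_
  · simpa using this
  · exact Matrix.mulVec_injective_of_isUnit (Matrix.isUnit_nonsing_inv_iff.2 (hu τ hτ))

theorem continuousOn_riccatiSol (hG : G.PosSemidef) (hN : Nᵀ = N) {h : ℝ}
    (hu : ∀ t ∈ Icc 0 h, IsUnit (hamExp A G N t).toBlocks₁₁) {Q : Matrix n n ℝ}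
    (hQ : (Q - reachGramian A G N h).PosDef) :
    ContinuousOn (riccatiSol A G N Q) (Icc 0 h) := fun τ hτ =>
  (hasDerivAt_riccatiSol hG.transpose_eq hN (hu τ hτ)
    (posDef_sub_reachGramian hG hN hu hQ hτ).isUnit).continuousAt.continuousWithinAt

end Riccati

/-! ## Quadratic forms along absolutely continuous curves -/

theorem AbsolutelyContinuousOnInterval.finset_sum {ι : Type*} (s : Finset ι) {f : ι → ℝ → ℝ}
    {a b : ℝ} (hf : ∀ i ∈ s, AbsolutelyContinuousOnInterval (f i) a b) :
    AbsolutelyContinuousOnInterval (fun t => ∑ i ∈ s, f i t) a b := by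
  classical
  induction s using Finset.induction_on with
  | empty =>
    exact ((LipschitzWith.const (0 : ℝ)).lipschitzOnWith (s := uIcc a b)).absolutelyContinuousOnInterval
  | insert i s hi ih =>
    simp only [Finset.sum_insert hi]
    exact (hf i (Finset.mem_insert_self i s)).fun_add
      (ih fun j hj => hf j (Finset.mem_insert_of_mem hj))

theorem absolutelyContinuousOnInterval_of_hasDerivAt {f f' : ℝ → ℝ} {a b : ℝ} (hab : a ≤ b)
    (hf : ∀ t ∈ Icc a b, HasDerivAt f (f' t) t) (hf' : ContinuousOn f' (Icc a b)) :
    AbsolutelyContinuousOnInterval f a b := by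
  obtain ⟨C, hC⟩ := isCompact_Icc.exists_bound_of_continuousOn hf'
  rw [← uIcc_of_le hab] at hf hC
  refine LipschitzOnWith.absolutelyContinuousOnInterval (K := C.toNNReal) ?_
  refine (convex_uIcc a b).lipschitzOnWith_of_nnnorm_hasDerivWithin_le
    (fun t ht => (hf t ht).hasDerivWithinAt) fun t ht => ?_
  rw [← NNReal.coe_le_coe, coe_nnnorm]
  exact (hC t ht).trans (Real.le_coe_toNNReal C)

section QuadraticAlongCurve

variable {n : Type*} [Fintype n]

/-- A Carathéodory solution is differentiable only almost everywhere. The quadratic form along it is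
absolutely continuous, so it is still the integral of its derivative, and an almost everywhere bound
on that derivative suffices. -/
theorem quadForm_le_of_deriv_le {f : ℝ → n → ℝ} {a b : ℝ} (hab : a ≤ b)
    (hf : IntervalIntegrable f volume a b) {x : ℝ → n → ℝ} {x₀ : n → ℝ}
    (hx : ∀ t ∈ Icc a b, x t = x₀ + ∫ s in a..t, f s)
    {P P' : ℝ → Matrix n n ℝ}
    (hP : ∀ i j, ∀ t ∈ Icc a b, HasDerivAt (fun s => P s i j) (P' t i j) t)
    (hP' : ∀ i j, ContinuousOn (fun t => P' t i j) (Icc a b))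
    {g : ℝ → ℝ} (hg : IntervalIntegrable g volume a b)
    (hle : ∀ t ∈ Icc a b,
      x t ⬝ᵥ P' t *ᵥ x t + f t ⬝ᵥ P t *ᵥ x t + x t ⬝ᵥ P t *ᵥ f t ≤ g t) :
    x b ⬝ᵥ P b *ᵥ x b ≤ x a ⬝ᵥ P a *ᵥ x a + ∫ t in a..b, g t := by
  have hfi : ∀ i, IntervalIntegrable (fun t => f t i) volume a b := fun i =>
    ⟨(ContinuousLinearMap.proj (R := ℝ) (φ := fun _ : n => ℝ) i).integrable_comp hf.1,
      (ContinuousLinearMap.proj (R := ℝ) (φ := fun _ : n => ℝ) i).integrable_comp hf.2⟩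
  -- The integral formula for `x` holds only on `[a, b]`; these primitives are defined on the whole
  -- line, so two-sided derivatives also make sense at the end points.
  set y : n → ℝ → ℝ := fun i t => x₀ i + ∫ s in a..t, f s i with hy
  have hxy : ∀ t ∈ Icc a b, ∀ i, x t i = y i t := fun t ht i => by
    have hft : IntervalIntegrable f volume a t :=
      hf.mono_set (by rw [uIcc_of_le ht.1, uIcc_of_le hab]; exact Icc_subset_Icc_right ht.2)
    rw [hx t ht, Pi.add_apply]
    exact congrArg (x₀ i + ·)
      ((ContinuousLinearMap.proj (R := ℝ) (φ := fun _ : n => ℝ) i).intervalIntegral_comp_comm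
        hft).symm
  have hyac : ∀ i, AbsolutelyContinuousOnInterval (y i) a b := fun i =>
    (((LipschitzWith.const (x₀ i)).lipschitzOnWith
      (s := uIcc a b)).absolutelyContinuousOnInterval).fun_add
      ((hfi i).absolutelyContinuousOnInterval_intervalIntegral (c := a) left_mem_uIcc)
  have hyd : ∀ᵐ t, t ∈ Icc a b → ∀ i, HasDerivAt (y i) (f t i) t := by
    have h1 := ae_all_iff.2 fun i => (hfi i).ae_hasDerivAt_integral
    filter_upwards [h1] with t ht hta i
    rw [uIcc_of_le hab] at ht
    exact (ht i hta a (left_mem_Icc.2 hab)).const_add _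
  set V : ℝ → ℝ := fun t => ∑ i, ∑ j, y i t * (P t i j * y j t) with hV
  have hVx : ∀ t ∈ Icc a b, V t = x t ⬝ᵥ P t *ᵥ x t := fun t ht => by
    simp only [hV, dotProduct, mulVec, hxy t ht, Finset.mul_sum]
  have hVac : AbsolutelyContinuousOnInterval V a b :=
    .finset_sum _ fun i _ => .finset_sum _ fun j _ => (hyac i).fun_mul
      ((absolutelyContinuousOnInterval_of_hasDerivAt hab (hP i j) (hP' i j)).fun_mul (hyac j))
  have hVd : ∀ᵐ t, t ∈ Icc a b → deriv V t ≤ g t := by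
    filter_upwards [hyd] with t ht hta
    have h1 : HasDerivAt V (∑ i, ∑ j, (f t i * (P t i j * y j t)
        + y i t * (P' t i j * y j t + P t i j * f t j))) t :=
      .fun_sum fun i _ => .fun_sum fun j _ =>
        (ht hta i).fun_mul ((hP i j t hta).fun_mul (ht hta j))
    rw [h1.deriv]
    refine le_trans (le_of_eq ?_) (hle t hta)
    simp only [dotProduct, mulVec, hxy t hta, Finset.mul_sum, ← Finset.sum_add_distrib]
    exact Finset.sum_congr rfl fun i _ => Finset.sum_congr rfl fun j _ => by ring
  have h2 := hVac.integral_deriv_eq_sub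
  have h3 : ∫ t in a..b, deriv V t ≤ ∫ t in a..b, g t :=
    intervalIntegral.integral_mono_ae_restrict hab hVac.intervalIntegrable_deriv hg
      ((ae_restrict_iff' measurableSet_Icc).2 hVd)
  rw [← hVx a (left_mem_Icc.2 hab), ← hVx b (right_mem_Icc.2 hab)]
  linarith

end QuadraticAlongCurve

/-! ## Dissipation during flow -/

theorem Matrix.mulVec_dotProduct_eq {m n : Type*} [Fintype m] [Fintype n] (M : Matrix m n ℝ)
    (a : n → ℝ) (b : m → ℝ) : (M *ᵥ a) ⬝ᵥ b = a ⬝ᵥ Mᵀ *ᵥ b := by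
  rw [mulVec_transpose, dotProduct_comm, dotProduct_mulVec, dotProduct_comm]

theorem Matrix.dotProduct_mulVec_comm {n : Type*} [Fintype n] {M : Matrix n n ℝ}
    (hM : Mᵀ = M) (a b : n → ℝ) : a ⬝ᵥ M *ᵥ b = b ⬝ᵥ M *ᵥ a := by
  rw [dotProduct_comm, mulVec_dotProduct_eq, hM]

theorem quadSupply_eq {w z : Type*} [Fintype w] [Fintype z]
    (Q : Matrix w w ℝ) (S : Matrix w z ℝ) (R : Matrix z z ℝ) (a : w → ℝ) (b : z → ℝ) :
    quadSupply Q S R a b = a ⬝ᵥ Q *ᵥ a + 2 * (a ⬝ᵥ S *ᵥ b) + b ⬝ᵥ R *ᵥ b := by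
  have h1 : b ⬝ᵥ Sᵀ *ᵥ a = a ⬝ᵥ S *ᵥ b := by
    rw [dotProduct_comm, mulVec_dotProduct_eq, transpose_transpose]
  simp only [quadSupply, fromBlocks_mulVec, Sum.elim_comp_inl, Sum.elim_comp_inr,
    sumElim_dotProduct_sumElim, dotProduct_add, h1]
  ring

namespace FlowSystem

variable {n wc zc : Type*} [Fintype n] [DecidableEq n] [Fintype wc] [DecidableEq wc] [Fintype zc]
  (T : FlowSystem n wc zc) (Q : Matrix wc wc ℝ) (S : Matrix wc zc ℝ) (R : Matrix zc zc ℝ)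

/-- The drift of the Riccati equation. -/
noncomputable def riccatiDrift : Matrix n n ℝ :=
  T.Ac - T.Bc * (T.M₂ Q S R)⁻¹ * (T.M₃ S R)ᵀ

/-- The quadratic coefficient of the Riccati equation. -/
noncomputable def riccatiGain : Matrix n n ℝ :=
  T.Bc * (T.M₂ Q S R)⁻¹ * T.Bcᵀ

/-- The constant term of the Riccati equation. -/
noncomputable def riccatiCost : Matrix n n ℝ :=
  T.M₁ R - T.M₃ S R * (T.M₂ Q S R)⁻¹ * (T.M₃ S R)ᵀ

theorem F_eq_hamExp (τ : ℝ) : T.F Q S R τ =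
    hamExp (T.riccatiDrift Q S R) (T.riccatiGain Q S R) (T.riccatiCost Q S R) τ :=
  rfl

/-- The matrix of the storage function at time `τ` before the next jump, if its inverse just before
the jump is `P`. -/
noncomputable def storage (P : Matrix n n ℝ) (τ : ℝ) : Matrix n n ℝ :=
  riccatiSol (T.riccatiDrift Q S R) (T.riccatiGain Q S R) (T.riccatiCost Q S R) P τ

/-- The set of inverse terminal storage matrices for which the Riccati equation is solvable up to
time `h`. -/
def Admissible (P : Matrix n n ℝ) (h : ℝ) : Prop :=
  (P - reachGramian (T.riccatiDrift Q S R) (T.riccatiGain Q S R) (T.riccatiCost Q S R) h).PosDef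

variable {T Q S R}

omit [DecidableEq n] in
theorem riccatiGain_posSemidef (hM : (T.M₂ Q S R).PosDef) : (T.riccatiGain Q S R).PosSemidef := by
  simpa [riccatiGain] using hM.inv.posSemidef.mul_mul_conjTranspose_same T.Bc

omit [DecidableEq n] in
theorem neg_riccatiCost_posSemidef (hR : (-R).PosSemidef) (hM : (T.M₂ Q S R).PosDef) :
    (-T.riccatiCost Q S R).PosSemidef := by
  have h1 := hM.inv.posSemidef.mul_mul_conjTranspose_same (T.M₃ S R)
  have h2 := hR.conjTranspose_mul_mul_same T.Cc
  have h3 := h2.add h1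
  convert! h3 using 1
  simp [riccatiCost, M₁, sub_eq_add_neg, add_comm]

omit [DecidableEq n] in
theorem riccatiCost_transpose (hR : (-R).PosSemidef) (hM : (T.M₂ Q S R).PosDef) :
    (T.riccatiCost Q S R)ᵀ = T.riccatiCost Q S R :=
  neg_injective (by rw [← transpose_neg, (neg_riccatiCost_posSemidef hR hM).transpose_eq])

omit [DecidableEq n] [DecidableEq wc] in
theorem quadSupply_output (hR : Rᵀ = R) (x : n → ℝ) (w : wc → ℝ) :
    quadSupply Q S R w (T.Cc *ᵥ x + T.Dc *ᵥ w) =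
      x ⬝ᵥ T.M₁ R *ᵥ x + 2 * ((T.M₃ S R)ᵀ *ᵥ x ⬝ᵥ w) + w ⬝ᵥ T.M₂ Q S R *ᵥ w := by
  have h1 : (S *ᵥ T.Dc *ᵥ w) ⬝ᵥ w = w ⬝ᵥ S *ᵥ T.Dc *ᵥ w := dotProduct_comm _ _
  have h2 : (S *ᵥ T.Cc *ᵥ x) ⬝ᵥ w = w ⬝ᵥ S *ᵥ T.Cc *ᵥ x := dotProduct_comm _ _
  have h3 := dotProduct_mulVec_comm hR (T.Cc *ᵥ x) (T.Dc *ᵥ w)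
  rw [mulVec_dotProduct_eq (T.M₃ S R)ᵀ]
  simp only [quadSupply_eq, M₁, M₂, M₃, transpose_transpose, add_mulVec, mulVec_add,
    dotProduct_add, add_dotProduct, ← mulVec_mulVec]
  simp only [← mulVec_dotProduct_eq, h1, h2, h3]
  ring

-- With `g = Bcᵀ P x` and `m = M₃ᵀ x`, the right side minus the left is exactly `(w - w*)ᵀ M₂ (w -
-- w*)` for the worst disturbance `w* = M₂⁻¹ (g - m)`. The first term on the left is the time
-- derivative of the storage matrix; its minus sign arises because `τ` runs backwards in time.
omit [DecidableEq n] in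
theorem riccati_completeSquare (hR : Rᵀ = R) (hM : (T.M₂ Q S R).PosDef) {P : Matrix n n ℝ}
    (hP : Pᵀ = P) (x : n → ℝ) (w : wc → ℝ) :
    x ⬝ᵥ (-(P * T.riccatiDrift Q S R + (T.riccatiDrift Q S R)ᵀ * P
        + P * T.riccatiGain Q S R * P - T.riccatiCost Q S R)) *ᵥ x
      + (T.Ac *ᵥ x + T.Bc *ᵥ w) ⬝ᵥ P *ᵥ x + x ⬝ᵥ P *ᵥ (T.Ac *ᵥ x + T.Bc *ᵥ w)
      ≤ quadSupply Q S R w (T.Cc *ᵥ x + T.Dc *ᵥ w) := by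
  rw [quadSupply_output hR]
  set M := T.M₂ Q S R with hMdef
  set g := T.Bcᵀ *ᵥ P *ᵥ x with hg
  set m := (T.M₃ S R)ᵀ *ᵥ x with hm
  have hMt : M⁻¹ᵀ = M⁻¹ := hM.inv.transpose_eq
  have hdet := (Matrix.isUnit_iff_isUnit_det _).1 hM.isUnit
  have h0 := hM.posSemidef.quadForm_nonneg (w - M⁻¹ *ᵥ (g - m))
  have h1 : (w - M⁻¹ *ᵥ (g - m)) ⬝ᵥ M *ᵥ (w - M⁻¹ *ᵥ (g - m)) =
      w ⬝ᵥ M *ᵥ w - 2 * (w ⬝ᵥ (g - m)) + (g - m) ⬝ᵥ M⁻¹ *ᵥ (g - m) := by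
    have e1 : M *ᵥ M⁻¹ *ᵥ (g - m) = g - m := by
      rw [mulVec_mulVec, Matrix.mul_nonsing_inv _ hdet, one_mulVec]
    have e2 : (M⁻¹ *ᵥ (g - m)) ⬝ᵥ M *ᵥ w = w ⬝ᵥ (g - m) := by
      rw [dotProduct_comm, mulVec_dotProduct_eq, hM.transpose_eq, e1]
    have e3 : (M⁻¹ *ᵥ (g - m)) ⬝ᵥ (g - m) = (g - m) ⬝ᵥ M⁻¹ *ᵥ (g - m) := by
      rw [mulVec_dotProduct_eq, hMt]
    simp only [mulVec_sub M, sub_dotProduct _ _ (M *ᵥ w - _), dotProduct_sub _ (M *ᵥ w), e1, e2, e3]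
    ring
  have hgx : ∀ v : wc → ℝ, x ⬝ᵥ P *ᵥ T.Bc *ᵥ v = g ⬝ᵥ v := fun v => by
    rw [hg, mulVec_dotProduct_eq, mulVec_dotProduct_eq, hP, transpose_transpose]
  have hmx : ∀ v : wc → ℝ, x ⬝ᵥ T.M₃ S R *ᵥ v = m ⬝ᵥ v := fun v => by
    rw [hm, mulVec_dotProduct_eq, transpose_transpose]
  have hAx : x ⬝ᵥ (T.riccatiDrift Q S R)ᵀ *ᵥ P *ᵥ x = x ⬝ᵥ P *ᵥ T.riccatiDrift Q S R *ᵥ x := by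
    rw [← mulVec_dotProduct_eq, dotProduct_comm, mulVec_dotProduct_eq, hP]
  have hdx : x ⬝ᵥ P *ᵥ T.riccatiDrift Q S R *ᵥ x
      = x ⬝ᵥ P *ᵥ T.Ac *ᵥ x - g ⬝ᵥ M⁻¹ *ᵥ m := by
    simp only [riccatiDrift, sub_mulVec, mulVec_sub, dotProduct_sub, ← mulVec_mulVec, hgx]
    rfl
  have hGx : x ⬝ᵥ P *ᵥ T.riccatiGain Q S R *ᵥ P *ᵥ x = g ⬝ᵥ M⁻¹ *ᵥ g := by
    simp only [riccatiGain, ← mulVec_mulVec, hgx]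
    rfl
  have hNx : x ⬝ᵥ T.riccatiCost Q S R *ᵥ x = x ⬝ᵥ T.M₁ R *ᵥ x - m ⬝ᵥ M⁻¹ *ᵥ m := by
    simp only [riccatiCost, sub_mulVec, dotProduct_sub, ← mulVec_mulVec, hmx]
    rfl
  have hcomm : (T.Ac *ᵥ x + T.Bc *ᵥ w) ⬝ᵥ P *ᵥ x = x ⬝ᵥ P *ᵥ (T.Ac *ᵥ x + T.Bc *ᵥ w) :=
    dotProduct_mulVec_comm hP _ _
  have hgm := dotProduct_mulVec_comm hMt g m
  rw [h1] at h0
  simp only [neg_mulVec, sub_mulVec, add_mulVec, dotProduct_neg, dotProduct_sub, dotProduct_add,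
    ← mulVec_mulVec, hAx, hdx, hGx, hNx, hcomm, mulVec_add, hgx, mulVec_sub, sub_dotProduct,
    dotProduct_comm w] at h0 ⊢
  linarith

theorem storage_zero (P : Matrix n n ℝ) : T.storage Q S R P 0 = P⁻¹ :=
  riccatiSol_zero P

theorem storage_posDef (hR : (-R).PosSemidef) (hM : (T.M₂ Q S R).PosDef) {h : ℝ}
    (hu : ∀ t ∈ Icc 0 h, IsUnit (T.F₁₁ Q S R t)) {P : Matrix n n ℝ}
    (hP : T.Admissible Q S R P h) {τ : ℝ} (hτ : τ ∈ Icc 0 h) : (T.storage Q S R P τ).PosDef :=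
  riccatiSol_posDef (riccatiGain_posSemidef hM) (neg_riccatiCost_posSemidef hR hM) hu hP hτ

theorem continuousOn_storage (hR : (-R).PosSemidef) (hM : (T.M₂ Q S R).PosDef) {h : ℝ}
    (hu : ∀ t ∈ Icc 0 h, IsUnit (T.F₁₁ Q S R t)) {P : Matrix n n ℝ}
    (hP : T.Admissible Q S R P h) : ContinuousOn (T.storage Q S R P) (Icc 0 h) :=
  continuousOn_riccatiSol (riccatiGain_posSemidef hM)
    (riccatiCost_transpose hR hM) hu hP

-- Here `c` is the time of the next jump, so the storage matrix at time `t` is taken at `τ = c - t`.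
open scoped Matrix.Norms.Operator in
theorem storage_flow_le (hR : (-R).PosSemidef) (hM : (T.M₂ Q S R).PosDef) {h : ℝ}
    (hu : ∀ t ∈ Icc 0 h, IsUnit (T.F₁₁ Q S R t)) {P : Matrix n n ℝ}
    (hP : T.Admissible Q S R P h) {a b c : ℝ} (hab : a ≤ b) (hbc : b ≤ c) (hca : c - h ≤ a)
    {x : ℝ → n → ℝ} {w : ℝ → wc → ℝ} {x₀ : n → ℝ}
    (hf : IntervalIntegrable (fun s => T.Ac *ᵥ x s + T.Bc *ᵥ w s) volume a b)
    (hx : ∀ t ∈ Icc a b, x t = x₀ + ∫ s in a..t, (T.Ac *ᵥ x s + T.Bc *ᵥ w s))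
    (hg : IntervalIntegrable (fun t => quadSupply Q S R (w t) (T.Cc *ᵥ x t + T.Dc *ᵥ w t))
      volume a b) :
    x b ⬝ᵥ T.storage Q S R P (c - b) *ᵥ x b ≤ x a ⬝ᵥ T.storage Q S R P (c - a) *ᵥ x a
      + ∫ t in a..b, quadSupply Q S R (w t) (T.Cc *ᵥ x t + T.Dc *ᵥ w t) := by
  have hN := riccatiCost_transpose hR hM
  have hG := riccatiGain_posSemidef hM
  have hR' : Rᵀ = R := by simpa using hR.transpose_eq
  have hmem : ∀ t ∈ Icc a b, c - t ∈ Icc 0 h := fun t ht =>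
    ⟨by linarith [ht.2], by linarith [ht.1]⟩
  set P' : ℝ → Matrix n n ℝ := fun t => -(T.storage Q S R P (c - t) * T.riccatiDrift Q S R
    + (T.riccatiDrift Q S R)ᵀ * T.storage Q S R P (c - t)
    + T.storage Q S R P (c - t) * T.riccatiGain Q S R * T.storage Q S R P (c - t)
    - T.riccatiCost Q S R) with hP'
  have hd : ∀ t ∈ Icc a b, HasDerivAt (fun s => T.storage Q S R P (c - s)) (P' t) t := by
    intro t ht
    have h1 := hasDerivAt_riccatiSol hG.transpose_eq hN (hu _ (hmem t ht))
      (posDef_sub_reachGramian hG hN hu hP (hmem t ht)).isUnit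
    have h2 := h1.scomp t ((hasDerivAt_id t).const_sub c)
    rw [neg_one_smul] at h2
    exact h2
  have hc : ContinuousOn (fun s => T.storage Q S R P (c - s)) (Icc a b) :=
    fun t ht => (hd t ht).continuousAt.continuousWithinAt
  have hc' : ContinuousOn P' (Icc a b) :=
    ((((hc.mul continuousOn_const).add (continuousOn_const.mul hc)).add
      ((hc.mul continuousOn_const).mul hc)).sub continuousOn_const).neg
  refine quadForm_le_of_deriv_le (P := fun t => T.storage Q S R P (c - t)) (P' := P') hab hf hx
    (fun i j t ht => ?_) (fun i j => ?_) hg (fun t ht => ?_)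
  · have := (hd t ht).matrix_quadForm (Pi.single i 1) (Pi.single j 1)
    simpa using this
  · exact (continuous_id.matrix_elem i j).comp_continuousOn hc'
  · exact riccati_completeSquare hR' hM (storage_posDef hR hM hu hP (hmem t ht)).transpose_eq _ _

end FlowSystem

/-! ## Uniform bounds on quadratic forms -/

section QuadFormBounds

variable {n : Type*} [Fintype n]

theorem isCompact_dotProduct_self_eq_one : IsCompact {x : n → ℝ | x ⬝ᵥ x = 1} := by
  refine Metric.isCompact_of_isClosed_isBounded
    (isClosed_eq (by fun_prop) continuous_const) ?_
  refine (Metric.isBounded_closedBall (x := (0 : n → ℝ)) (r := 1)).subset fun x hx => ?_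
  rw [mem_closedBall_zero_iff, pi_norm_le_iff_of_nonneg zero_le_one]
  intro i
  have h1 : x i * x i ≤ x ⬝ᵥ x :=
    Finset.single_le_sum (f := fun j => x j * x j) (fun j _ => mul_self_nonneg _) (Finset.mem_univ i)
  rw [show x ⬝ᵥ x = 1 from hx] at h1
  rw [Real.norm_eq_abs]
  exact abs_le_one_iff_mul_self_le_one.2 h1

theorem quadForm_nonneg_of_unit {M : Matrix n n ℝ}
    (hM : ∀ u : n → ℝ, u ⬝ᵥ u = 1 → 0 ≤ u ⬝ᵥ M *ᵥ u) (x : n → ℝ) : 0 ≤ x ⬝ᵥ M *ᵥ x := by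
  by_cases hx : x = 0
  · simp [hx]
  have hpos : 0 < x ⬝ᵥ x := by
    simpa using (Matrix.dotProduct_star_self_pos_iff (v := x)).2 hx
  set r := √(x ⬝ᵥ x) with hr
  have hr0 : 0 < r := Real.sqrt_pos.2 hpos
  have hrr : r * r = x ⬝ᵥ x := Real.mul_self_sqrt hpos.le
  have h1 := hM (r⁻¹ • x) (by
    rw [smul_dotProduct, dotProduct_smul, ← hrr, smul_eq_mul, smul_eq_mul]
    field_simp)
  rw [mulVec_smul, smul_dotProduct, dotProduct_smul, smul_eq_mul, smul_eq_mul, ← mul_assoc] at h1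
  exact nonneg_of_mul_nonneg_right h1 (by positivity)

/-- The minimum over `K` times the unit sphere is positive by compactness. The sphere is that of the
dot product, since the norm of `n → ℝ` is the sup norm. -/
theorem exists_pos_mul_le_quadForm [DecidableEq n] {K : Set ℝ} (hK : IsCompact K)
    {A : ℝ → Matrix n n ℝ} (hA : ContinuousOn A K) (hpos : ∀ t ∈ K, (A t).PosDef) :
    ∃ δ > 0, ∀ t ∈ K, ∀ x, δ * (x ⬝ᵥ x) ≤ x ⬝ᵥ A t *ᵥ x := by
  have hc : ContinuousOn (fun p : ℝ × (n → ℝ) => p.2 ⬝ᵥ A p.1 *ᵥ p.2)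
      (K ×ˢ {x : n → ℝ | x ⬝ᵥ x = 1}) := by
    have h1 : Continuous (fun p : Matrix n n ℝ × (n → ℝ) => p.2 ⬝ᵥ p.1 *ᵥ p.2) := by fun_prop
    exact h1.comp_continuousOn
      ((hA.comp continuousOn_fst fun p hp => hp.1).prodMk continuousOn_snd)
  obtain ⟨δ, hδ, hle⟩ := (hK.prod isCompact_dotProduct_self_eq_one).exists_forall_le' hc (a := 0)
    fun p hp => (hpos p.1 hp.1).quadForm_pos fun h0 => by simpa [h0] using hp.2
  refine ⟨δ, hδ, fun t ht x => ?_⟩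
  have := quadForm_nonneg_of_unit (M := A t - δ • 1) (fun u hu => by
    have := hle (t, u) ⟨ht, hu⟩
    simpa [sub_mulVec, smul_mulVec, hu] using this) x
  simpa [sub_mulVec, smul_mulVec] using this

theorem exists_quadForm_le_mul [DecidableEq n] (B : Matrix n n ℝ) :
    ∃ C > 0, ∀ x, x ⬝ᵥ B *ᵥ x ≤ C * (x ⬝ᵥ x) := by
  obtain ⟨C, hC⟩ := isCompact_dotProduct_self_eq_one.exists_bound_of_continuousOn
    (f := fun x : n → ℝ => x ⬝ᵥ B *ᵥ x) (by fun_prop)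
  refine ⟨max C 1, by positivity, fun x => ?_⟩
  have := quadForm_nonneg_of_unit (M := max C 1 • 1 - B) (fun u hu => by
    have := ((le_abs_self _).trans (hC u hu)).trans (le_max_left C 1)
    simpa [sub_mulVec, smul_mulVec, hu] using this) x
  simpa [sub_mulVec, smul_mulVec] using this

end QuadFormBounds

/-! ## Integrability of the supply -/

theorem continuous_quadSupply {w z : Type*} [Fintype w] [Fintype z]
    (Q : Matrix w w ℝ) (S : Matrix w z ℝ) (R : Matrix z z ℝ) :
    Continuous fun p : (w → ℝ) × (z → ℝ) => quadSupply Q S R p.1 p.2 := by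
  simp only [quadSupply_eq]
  fun_prop

theorem MeasureTheory.MemLp.exists_ae_norm_le {α E : Type*} [MeasurableSpace α]
    {μ : Measure α} [NormedAddCommGroup E] {f : α → E} (hf : MemLp f ⊤ μ) :
    ∃ C, ∀ᵐ t ∂μ, ‖f t‖ ≤ C := by
  have h1 : eLpNormEssSup f μ ≠ ⊤ := by simpa using hf.eLpNorm_ne_top
  refine ⟨(eLpNormEssSup f μ).toReal, ?_⟩
  filter_upwards [enorm_ae_le_eLpNormEssSup f μ] with t ht
  rw [← toReal_enorm]
  exact ENNReal.toReal_mono h1 ht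

theorem intervalIntegrable_quadSupply {w z : Type*} [Fintype w] [Fintype z]
    (Q : Matrix w w ℝ) (S : Matrix w z ℝ) (R : Matrix z z ℝ) {f : ℝ → w → ℝ} {g : ℝ → z → ℝ}
    (hf : MemLp f ⊤ (volume.restrict (Ici 0))) (hg : MemLp g ⊤ (volume.restrict (Ici 0)))
    {a b : ℝ} (ha : 0 ≤ a) (hab : a ≤ b) :
    IntervalIntegrable (fun t => quadSupply Q S R (f t) (g t)) volume a b := by
  rw [intervalIntegrable_iff_integrableOn_Ioc_of_le hab]
  have hle : volume.restrict (Ioc a b) ≤ volume.restrict (Ici 0) :=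
    Measure.restrict_mono (fun t ht => ha.trans ht.1.le) le_rfl
  have hf' := hf.mono_measure hle
  have hg' := hg.mono_measure hle
  obtain ⟨C₁, h₁⟩ := hf'.exists_ae_norm_le
  obtain ⟨C₂, h₂⟩ := hg'.exists_ae_norm_le
  obtain ⟨C, hC⟩ := ((isCompact_closedBall (0 : w → ℝ) C₁).prod
    (isCompact_closedBall (0 : z → ℝ) C₂)).exists_bound_of_continuousOn
      (continuous_quadSupply Q S R).continuousOn
  refine IntegrableOn.of_bound (by simp)
    ((continuous_quadSupply Q S R).comp_aestronglyMeasurable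
      (hf'.aestronglyMeasurable.prodMk hg'.aestronglyMeasurable)) C ?_
  filter_upwards [h₁, h₂] with t ht₁ ht₂
  exact hC (f t, g t) ⟨by simpa using ht₁, by simpa using ht₂⟩

/-! ## Dissipation along trajectories -/

namespace LPJF

variable {n wc wd zc zd : Type*} [Fintype n] [DecidableEq n] [Fintype wc] [DecidableEq wc]
  [Fintype wd] [Fintype zc] {T : LPJF n wc wd zc zd} {h : ℝ}
  {ξ : ℝ → n → ℝ} {w : ℝ → wc → ℝ} {v : ℕ → wd → ℝ} {z : ℝ → zc → ℝ} {ζ : ℕ → zd → ℝ}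

/-- The state right after the `k`-th jump. -/
def postJump (T : LPJF n wc wd zc zd) (h : ℝ) (ξ : ℝ → n → ℝ) (v : ℕ → wd → ℝ) (k : ℕ) : n → ℝ :=
  T.Ad *ᵥ ξ (k * h) + T.Bd *ᵥ v k

/-- The state on the `k`-th flow interval, closed at its left end by the state after the jump. -/
noncomputable def segment (T : LPJF n wc wd zc zd) (h : ℝ) (ξ : ℝ → n → ℝ) (v : ℕ → wd → ℝ)
    (k : ℕ) : ℝ → n → ℝ :=
  Function.update ξ (k * h) (T.postJump h ξ v k)

theorem segment_left (k : ℕ) : T.segment h ξ v k (k * h) = T.postJump h ξ v k := by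
  simp [segment]

theorem segment_of_lt (k : ℕ) {t : ℝ} (ht : k * h < t) : T.segment h ξ v k t = ξ t := by
  simp [segment, ht.ne']

theorem IsTrajectory.intervalIntegrable_segment (hT : T.IsTrajectory h ξ w v z ζ) (hh : 0 < h)
    (k : ℕ) : IntervalIntegrable (fun s => T.Ac *ᵥ T.segment h ξ v k s + T.Bc *ᵥ w s) volume
      (k * h) ((k + 1) * h) := by
  refine (hT.intervalIntegrable k).congr fun t ht => ?_
  rw [uIoc_of_le (by nlinarith)] at ht
  simp only [segment_of_lt k ht.1]

/-- Replacing the pre-jump value at `k h` by the post-jump value extends the flow equation to the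
closed interval, without changing the integral. -/
theorem IsTrajectory.segment_eq (hT : T.IsTrajectory h ξ w v z ζ) (k : ℕ)
    {t : ℝ} (ht : t ∈ Icc (k * h) ((k + 1) * h)) :
    T.segment h ξ v k t = T.postJump h ξ v k
      + ∫ s in (k * h)..t, (T.Ac *ᵥ T.segment h ξ v k s + T.Bc *ᵥ w s) := by
  rcases ht.1.eq_or_lt with h1 | h1
  · rw [← h1, segment_left, intervalIntegral.integral_same, add_zero]
  · rw [segment_of_lt k h1, hT.flow k t ⟨h1, ht.2⟩]
    congr 1
    refine intervalIntegral.integral_congr_ae (.of_forall fun s hs => ?_)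
    rw [uIoc_of_le h1.le] at hs
    rw [segment_of_lt k hs.1]

theorem IsTrajectory.segment_eq' (hT : T.IsTrajectory h ξ w v z ζ) (hh : 0 < h) (k : ℕ)
    {a t : ℝ} (ha : k * h ≤ a) (hat : a ≤ t) (ht : t ≤ (k + 1) * h) :
    T.segment h ξ v k t = T.segment h ξ v k a
      + ∫ s in a..t, (T.Ac *ᵥ T.segment h ξ v k s + T.Bc *ᵥ w s) := by
  have hi := hT.intervalIntegrable_segment hh k
  have hk : (k : ℝ) * h ≤ (k + 1) * h := by nlinarith
  rw [hT.segment_eq k ⟨ha.trans hat, ht⟩, hT.segment_eq k ⟨ha, hat.trans ht⟩, add_assoc,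
    intervalIntegral.integral_add_adjacent_intervals]
  · exact hi.mono_set (uIcc_subset_uIcc left_mem_uIcc
      (by rw [uIcc_of_le hk]; exact ⟨ha, hat.trans ht⟩))
  · exact hi.mono_set (uIcc_subset_uIcc (by rw [uIcc_of_le hk]; exact ⟨ha, hat.trans ht⟩)
      (by rw [uIcc_of_le hk]; exact ⟨ha.trans hat, ht⟩))

theorem IsTrajectory.continuousOn_segment (hT : T.IsTrajectory h ξ w v z ζ) (hh : 0 < h)
    (k : ℕ) : ContinuousOn (T.segment h ξ v k) (Icc (k * h) ((k + 1) * h)) := by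
  have hk : (k : ℝ) * h ≤ (k + 1) * h := by nlinarith
  have h1 := intervalIntegral.continuousOn_primitive_interval'
    (hT.intervalIntegrable_segment hh k) left_mem_uIcc
  rw [uIcc_of_le hk] at h1
  exact (continuousOn_const.add h1).congr fun t ht => hT.segment_eq k ht

variable {Q : Matrix wc wc ℝ} {S : Matrix wc zc ℝ} {R : Matrix zc zc ℝ} {P : Matrix n n ℝ}

theorem IsTrajectory.quadSupply_segment (hT : T.IsTrajectory h ξ w v z ζ) (hh : 0 < h) (k : ℕ)
    {t : ℝ} (ht : k * h < t) : quadSupply Q S R (w t) (z t) =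
      quadSupply Q S R (w t) (T.Cc *ᵥ T.segment h ξ v k t + T.Dc *ᵥ w t) := by
  rw [hT.flowOutput t ((by positivity : (0 : ℝ) ≤ k * h).trans_lt ht), segment_of_lt k ht]

theorem IsTrajectory.storage_segment_le (hT : T.IsTrajectory h ξ w v z ζ) (hh : 0 < h)
    (hR : (-R).PosSemidef) (hM : (T.M₂ Q S R).PosDef)
    (hu : ∀ t ∈ Icc 0 h, IsUnit (T.F₁₁ Q S R t)) (hP : T.Admissible Q S R P h) (k : ℕ)
    {a b : ℝ} (ha : k * h ≤ a) (hab : a ≤ b) (hb : b ≤ (k + 1) * h)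
    (hg : IntervalIntegrable (fun t => quadSupply Q S R (w t) (z t)) volume a b) :
    T.segment h ξ v k b ⬝ᵥ T.storage Q S R P ((k + 1) * h - b) *ᵥ T.segment h ξ v k b
      ≤ T.segment h ξ v k a ⬝ᵥ T.storage Q S R P ((k + 1) * h - a) *ᵥ T.segment h ξ v k a
        + ∫ t in a..b, quadSupply Q S R (w t) (z t) := by
  have hk : (k : ℝ) * h ≤ (k + 1) * h := by nlinarith
  have hcongr : ∀ t ∈ uIoc a b, quadSupply Q S R (w t) (z t) =
      quadSupply Q S R (w t) (T.Cc *ᵥ T.segment h ξ v k t + T.Dc *ᵥ w t) := fun t ht => by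
    rw [uIoc_of_le hab] at ht
    exact hT.quadSupply_segment hh k (ha.trans_lt ht.1)
  rw [intervalIntegral.integral_congr_ae (.of_forall hcongr)]
  refine FlowSystem.storage_flow_le hR hM hu hP hab hb (by linarith) ?_
    (x₀ := T.segment h ξ v k a) (fun t ht => hT.segment_eq' hh k ha ht.1 (ht.2.trans hb))
    (hg.congr hcongr)
  refine (hT.intervalIntegrable_segment hh k).mono_set (uIcc_subset_uIcc ?_ ?_) <;>
  rw [uIcc_of_le hk]
  exacts [⟨ha, hab.trans hb⟩, ⟨ha.trans hab, hb⟩]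

end LPJF

/-! ### From storage inequalities to dissipativity and exponential stability -/

namespace LPJF

variable {n wc wd zc zd : Type*} [Fintype n] [DecidableEq n] [Fintype wc] [DecidableEq wc]
  [Fintype wd] [Fintype zc] [Fintype zd] {T : LPJF n wc wd zc zd} {h : ℝ}
  {Q : Matrix wc wc ℝ} {S : Matrix wc zc ℝ} {R : Matrix zc zc ℝ} {P : Matrix n n ℝ}
  {Qd : Matrix wd wd ℝ} {Sd : Matrix wd zd ℝ} {Rd : Matrix zd zd ℝ}

theorem natCeil_div_eq (hh : 0 < h) (k : ℕ) {t : ℝ} (h1 : k * h < t) (h2 : t ≤ (k + 1) * h) :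
    ⌈t / h⌉₊ = k + 1 := by
  rw [Nat.ceil_eq_iff (by simp)]
  constructor
  · rw [lt_div_iff₀ hh]
    simpa using h1
  · rw [div_le_iff₀ hh]
    exact_mod_cast h2

theorem natCeil_mul_sub_mem (hh : 0 < h) {t : ℝ} (ht : 0 ≤ t) :
    ⌈t / h⌉₊ * h - t ∈ Icc 0 h := by
  have h1 := (div_le_iff₀ hh).1 (Nat.le_ceil (t / h))
  have h2 := (Nat.ceil_lt_add_one (div_nonneg ht hh.le)).le
  have h3 : ⌈t / h⌉₊ * h ≤ (t / h + 1) * h := by gcongr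
  rw [add_mul, div_mul_cancel₀ _ hh.ne'] at h3
  exact ⟨by linarith, by linarith⟩

theorem antitoneOn_Ici_of_forall_Icc (hh : 0 < h) {f : ℝ → ℝ}
    (hf : ∀ k : ℕ, AntitoneOn f (Icc (k * h) ((k + 1) * h))) : AntitoneOn f (Ici 0) := by
  have h1 : ∀ k : ℕ, AntitoneOn f (Icc 0 (k * h)) := fun k => by
    induction k with
    | zero => simp
    | succ k ih =>
      have hk : (0 : ℝ) ≤ k * h := by positivity
      have hk' : (k : ℝ) * h ≤ (k + 1) * h := by nlinarith
      have := ih.union_right (hf k) (isGreatest_Icc hk) (isLeast_Icc hk')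
      rw [Icc_union_Icc_eq_Icc hk hk'] at this
      exact_mod_cast this
  intro a ha b hb hab
  have hb' := (div_le_iff₀ hh).1 (Nat.le_ceil (b / h))
  exact h1 ⌈b / h⌉₊ ⟨ha, hab.trans hb'⟩ ⟨hb, hb'⟩ hab

/-- A flow which is admissible for the Riccati equation up to time `h`, together with a jump
which does not increase the storage by more than its supply, is dissipative. -/
theorem isDissipative_of_storage (hh : 0 < h) (hR : (-R).PosSemidef) (hM : (T.M₂ Q S R).PosDef)
    (hu : ∀ t ∈ Icc 0 h, IsUnit (T.F₁₁ Q S R t)) (hP : T.Admissible Q S R P h)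
    (hjump : ∀ x d, (T.Ad *ᵥ x + T.Bd *ᵥ d) ⬝ᵥ T.storage Q S R P h *ᵥ (T.Ad *ᵥ x + T.Bd *ᵥ d)
      ≤ x ⬝ᵥ P⁻¹ *ᵥ x + quadSupply Qd Sd Rd d (T.Cd *ᵥ x + T.Dd *ᵥ d)) :
    T.IsDissipative h (quadSupply Q S R) (quadSupply Qd Sd Rd) := by
  -- The number `⌈t / h⌉₊ * h - t` is the time to the next jump; it is `0` at `t = k h`, in
  -- agreement with `ξ (k h)` being the value before the jump.
  refine ⟨fun x t => x ⬝ᵥ T.storage Q S R P (⌈t / h⌉₊ * h - t) *ᵥ x, fun x t ht =>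
    (FlowSystem.storage_posDef hR hM hu hP
      (natCeil_mul_sub_mem hh ht)).posSemidef.quadForm_nonneg x, ?_⟩
  intro ξ w v z ζ hT hw hz _ _ t₀ t₁ ht₀ ht₁
  set g : ℝ → ℝ := fun t => quadSupply Q S R (w t) (z t) with hg
  have hgi : ∀ {a b : ℝ}, 0 ≤ a → a ≤ b → IntervalIntegrable g volume a b :=
    fun ha hab => intervalIntegrable_quadSupply Q S R hw hz ha hab
  set V : ℝ → ℝ := fun t => ξ t ⬝ᵥ T.storage Q S R P (⌈t / h⌉₊ * h - t) *ᵥ ξ t with hV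
  -- Storage minus all supply received since time `0`. The dissipation inequality says that this is
  -- nonincreasing, which can be checked on each interval `[k h, (k + 1) h]` and glued.
  set Φ : ℝ → ℝ := fun t => V t - (∫ s in (0 : ℝ)..t, g s)
    - ∑ k ∈ Finset.range ⌈t / h⌉₊, quadSupply Qd Sd Rd (v k) (ζ k) with hΦ
  have hanti : AntitoneOn Φ (Ici 0) := by
    refine antitoneOn_Ici_of_forall_Icc hh fun k a ha b hb hab => ?_
    have hk : (0 : ℝ) ≤ k * h := by positivity
    have hVt : ∀ t, k * h < t → t ≤ (k + 1) * h → V t = T.segment h ξ v k t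
        ⬝ᵥ T.storage Q S R P ((k + 1) * h - t) *ᵥ T.segment h ξ v k t := fun t h1 h2 => by
      simp only [hV, natCeil_div_eq hh k h1 h2, segment_of_lt k h1]
      push_cast
      rfl
    have hseg := hT.storage_segment_le hh hR hM hu hP k ha.1 hab hb.2 (hgi (hk.trans ha.1) hab)
    have hint : (∫ s in (0 : ℝ)..b, g s) - ∫ s in (0 : ℝ)..a, g s = ∫ s in a..b, g s :=
      intervalIntegral.integral_interval_sub_left (hgi le_rfl (hk.trans hb.1))
        (hgi le_rfl (hk.trans ha.1))
    -- If `a = k h`, passing from `a` to a later time includes the `k`-th jump; otherwise there is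
    -- only flow.
    rcases ha.1.eq_or_lt with hka | hka
    · rcases hab.eq_or_lt with hab' | hab'
      · rw [hab']
      have hkb : k * h < b := hka.trans_lt hab'
      have hVa : V a = ξ a ⬝ᵥ P⁻¹ *ᵥ ξ a := by
        simp [hV, ← hka, hh.ne', FlowSystem.storage_zero]
      have hca : ⌈a / h⌉₊ = k := by simp [← hka, hh.ne']
      have hj := hjump (ξ (k * h)) (v k)
      rw [← hT.jumpOutput k] at hj
      rw [← hVt b hkb hb.2, ← hka, segment_left, hka, show (k + 1) * h - a = h by
        rw [← hka]; ring] at hseg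
      simp only [hΦ, natCeil_div_eq hh k hkb hb.2, hca, Finset.sum_range_succ, hVa]
      rw [hka] at hj
      have hpost : T.postJump h ξ v k = T.Ad *ᵥ ξ a + T.Bd *ᵥ v k := by rw [postJump, hka]
      rw [hpost] at hseg
      linarith
    · have hkb : k * h < b := hka.trans_le hab
      rw [← hVt b hkb hb.2, ← hVt a hka ha.2] at hseg
      simp only [hΦ, natCeil_div_eq hh k hkb hb.2, natCeil_div_eq hh k hka ha.2]
      linarith
  have hfin := hanti ht₀ (ht₀.trans ht₁) ht₁
  have hint : (∫ s in (0 : ℝ)..t₁, g s) - ∫ s in (0 : ℝ)..t₀, g s = ∫ s in t₀..t₁, g s :=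
    intervalIntegral.integral_interval_sub_left (hgi le_rfl (ht₀.trans ht₁)) (hgi le_rfl ht₀)
  have hceil : ⌈t₀ / h⌉₊ ≤ ⌈t₁ / h⌉₊ := Nat.ceil_mono (by gcongr)
  rw [Finset.sum_Ico_eq_sub _ hceil]
  simp only [hΦ] at hfin
  change V t₁ ≤ V t₀ + (∫ t in t₀..t₁, g t) + _
  linarith

theorem quadSupply_zero_left_nonpos {w z : Type*} [Fintype w] [Fintype z]
    {Q : Matrix w w ℝ} {S : Matrix w z ℝ} {R : Matrix z z ℝ} (hR : (-R).PosSemidef) (b : z → ℝ) :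
    quadSupply Q S R 0 b ≤ 0 := by
  have := hR.quadForm_nonneg b
  simp only [neg_mulVec, dotProduct_neg] at this
  simp only [quadSupply_eq, zero_dotProduct]
  linarith

/-- If the flow is admissible for the Riccati equation up to time `h` and undisturbed jumps
strictly decrease the storage, then the origin is globally exponentially stable. -/
theorem isGES_of_storage (hh : 0 < h) (hR : (-R).PosSemidef) (hM : (T.M₂ Q S R).PosDef)
    (hu : ∀ t ∈ Icc 0 h, IsUnit (T.F₁₁ Q S R t)) (hPpos : P.PosDef)
    (hP : T.Admissible Q S R P h)
    (hjump : ∀ x, x ≠ 0 → (T.Ad *ᵥ x) ⬝ᵥ T.storage Q S R P h *ᵥ (T.Ad *ᵥ x) < x ⬝ᵥ P⁻¹ *ᵥ x) :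
    T.IsGES h := by
  have hst : ∀ τ ∈ Icc 0 h, (T.storage Q S R P τ).PosDef :=
    fun τ hτ => FlowSystem.storage_posDef hR hM hu hP hτ
  obtain ⟨δ, hδ, hδle⟩ := exists_pos_mul_le_quadForm isCompact_Icc
    (FlowSystem.continuousOn_storage hR hM hu hP) hst
  obtain ⟨C, hC, hCle⟩ := exists_quadForm_le_mul P⁻¹
  have hhmem : h ∈ Icc 0 h := ⟨hh.le, le_rfl⟩
  obtain ⟨ρ, hρ0, hρ1, hρ⟩ : ∃ ρ, 0 < ρ ∧ ρ < 1 ∧ ∀ x,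
      (T.Ad *ᵥ x) ⬝ᵥ T.storage Q S R P h *ᵥ (T.Ad *ᵥ x) ≤ ρ * (x ⬝ᵥ P⁻¹ *ᵥ x) := by
    have hD : (P⁻¹ - T.Adᵀ * T.storage Q S R P h * T.Ad).PosDef := by
      refine .of_dotProduct_mulVec_pos ?_ fun x hx => ?_
      · simp [Matrix.IsHermitian, transpose_nonsing_inv, hPpos.transpose_eq, mul_assoc,
          (hst h hhmem).transpose_eq]
      · have := hjump x hx
        simp only [star_trivial, sub_mulVec, dotProduct_sub, ← mulVec_mulVec,
          ← mulVec_dotProduct_eq]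
        linarith
    obtain ⟨ε, hε, hεle⟩ := exists_pos_mul_le_quadForm (K := {0}) isCompact_singleton
      (A := fun _ => P⁻¹ - T.Adᵀ * T.storage Q S R P h * T.Ad) continuousOn_const fun _ _ => hD
    -- The strict decrease is at least `ε ‖x‖²`, hence at least `ε / C` times the storage before the
    -- jump. The maximum with `1 / 2` only keeps `ρ` positive, for its logarithm.
    refine ⟨max (1 - ε / C) (1 / 2), by positivity, max_lt ?_ (by norm_num), fun x => ?_⟩
    · have : 0 < ε / C := by positivity
      linarith
    have h1 := hεle 0 rfl x
    have h2 := hCle x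
    have h3 := hPpos.inv.posSemidef.quadForm_nonneg x
    simp only [sub_mulVec, dotProduct_sub, ← mulVec_mulVec, ← mulVec_dotProduct_eq] at h1
    have h4 : ε / C * (x ⬝ᵥ P⁻¹ *ᵥ x) ≤ ε * (x ⬝ᵥ x) := by
      rw [div_mul_eq_mul_div, div_le_iff₀ hC]
      nlinarith
    have h5 := mul_le_mul_of_nonneg_right (le_max_left (1 - ε / C) (1 / 2)) h3
    linarith
  -- The storage contracts by `ρ = exp (-2 α h)` per period; the factor `2` is there because the
  -- norm is a square root of a quadratic form.
  set α := -Real.log ρ / (2 * h) with hα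
  have hα0 : 0 < α := div_pos (neg_pos.2 (Real.log_neg hρ0 hρ1)) (by positivity)
  have hρexp : ρ = Real.exp (-(2 * α * h)) := by
    rw [hα, show -(2 * (-Real.log ρ / (2 * h)) * h) = Real.log ρ by field_simp,
      Real.exp_log hρ0]
  refine ⟨√(C / δ), by positivity, α, hα0, fun ξ z ζ hT t ht => ?_⟩
  have hstep : ∀ k : ℕ, ∀ s ∈ Ioc (k * h) ((k + 1) * h),
      ξ s ⬝ᵥ T.storage Q S R P ((k + 1) * h - s) *ᵥ ξ s
        ≤ ρ * (ξ (k * h) ⬝ᵥ P⁻¹ *ᵥ ξ (k * h)) := by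
    intro k s hs
    have hcont := (hT.continuousOn_segment hh k).mono (Icc_subset_Icc_right hs.2)
    have hg : IntervalIntegrable
        (fun t => quadSupply Q S R ((0 : ℝ → wc → ℝ) t) (z t)) volume (k * h) s := by
      -- Integrability cannot come from boundedness assumptions here: with `w = 0` the output is a
      -- continuous function of the segment.
      have h1 : ContinuousOn (fun t => quadSupply Q S R (0 : wc → ℝ)
          (T.Cc *ᵥ T.segment h ξ 0 k t + T.Dc *ᵥ (0 : wc → ℝ))) (Icc (k * h) s) := by
        refine (continuous_quadSupply Q S R).comp_continuousOn
          (continuousOn_const.prodMk (ContinuousOn.add ?_ continuousOn_const))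
        exact (Continuous.matrix_mulVec continuous_const continuous_id).comp_continuousOn hcont
      rw [← uIcc_of_le hs.1.le] at h1
      refine h1.intervalIntegrable.congr fun t ht => ?_
      rw [uIoc_of_le hs.1.le] at ht
      exact (hT.quadSupply_segment hh k ht.1).symm
    have h1 := hT.storage_segment_le hh hR hM hu hP k le_rfl hs.1.le hs.2 hg
    have h2 : ∫ t in (k * h)..s, quadSupply Q S R ((0 : ℝ → wc → ℝ) t) (z t) ≤ 0 := by
      have := intervalIntegral.integral_mono_on hs.1.le hg (intervalIntegrable_const (c := (0 : ℝ)))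
        fun t _ => quadSupply_zero_left_nonpos hR (z t)
      simpa using this
    rw [segment_of_lt k hs.1, segment_left, show ((k : ℝ) + 1) * h - k * h = h by ring] at h1
    have h3 : T.postJump h ξ 0 k = T.Ad *ᵥ ξ (k * h) := by simp [postJump]
    rw [h3] at h1
    linarith [hρ (ξ (k * h))]
  have hiter : ∀ k : ℕ, ξ (k * h) ⬝ᵥ P⁻¹ *ᵥ ξ (k * h) ≤ ρ ^ k * (ξ 0 ⬝ᵥ P⁻¹ *ᵥ ξ 0) := by
    intro k
    induction k with
    | zero => simp
    | succ k ih =>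
      have := hstep k ((k + 1) * h) ⟨by nlinarith, le_rfl⟩
      rw [sub_self, FlowSystem.storage_zero] at this
      push_cast
      rw [pow_succ]
      nlinarith
  have hmain : δ * (ξ t ⬝ᵥ ξ t) ≤ Real.exp (-(2 * α * t)) * (C * (ξ 0 ⬝ᵥ ξ 0)) := by
    have h0 := hPpos.inv.posSemidef.quadForm_nonneg (ξ 0)
    rcases ht.eq_or_lt with ht0 | ht0
    · have := hδle 0 ⟨le_rfl, hh.le⟩ (ξ 0)
      rw [FlowSystem.storage_zero] at this
      simpa [← ht0] using this.trans (hCle (ξ 0))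
    · obtain ⟨k, hk⟩ : ∃ k : ℕ, ⌈t / h⌉₊ = k + 1 :=
        Nat.exists_eq_succ_of_ne_zero (Nat.ceil_pos.2 (by positivity)).ne'
      rw [Nat.ceil_eq_iff (by simp)] at hk
      have hs : t ∈ Ioc (k * h) ((k + 1) * h) := by
        refine ⟨?_, ?_⟩
        · have := (lt_div_iff₀ hh).1 hk.1
          simpa using this
        · have := (div_le_iff₀ hh).1 hk.2
          exact_mod_cast this
      have h1 := hδle ((k + 1) * h - t) ⟨by linarith [hs.2], by linarith [hs.1]⟩ (ξ t)
      have h2 := hstep k t hs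
      -- At a time `t ≤ (k + 1) h` after the `k`-th jump, `k + 1` jumps have occurred, so no
      -- constant is lost on an incomplete period.
      have h3 : ρ ^ (k + 1) ≤ Real.exp (-(2 * α * t)) := by
        rw [hρexp, ← Real.exp_nat_mul]
        refine Real.exp_le_exp.2 ?_
        push_cast
        nlinarith [hs.2]
      calc δ * (ξ t ⬝ᵥ ξ t) ≤ ρ * (ξ (k * h) ⬝ᵥ P⁻¹ *ᵥ ξ (k * h)) := h1.trans h2
        _ ≤ ρ * (ρ ^ k * (ξ 0 ⬝ᵥ P⁻¹ *ᵥ ξ 0)) := by gcongr; exact hiter k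
        _ = ρ ^ (k + 1) * (ξ 0 ⬝ᵥ P⁻¹ *ᵥ ξ 0) := by ring
        _ ≤ Real.exp (-(2 * α * t)) * (C * (ξ 0 ⬝ᵥ ξ 0)) := by gcongr; exact hCle _
  have hexp : Real.exp (-(2 * α * t)) = Real.exp (-α * t) ^ 2 := by
    rw [← Real.exp_nat_mul]
    congr 1
    push_cast
    ring
  rw [← Real.sqrt_sq (Real.exp_pos (-α * t)).le, ← Real.sqrt_mul (by positivity),
    ← Real.sqrt_mul (by positivity)]
  refine Real.sqrt_le_sqrt ?_
  rw [← hexp, div_mul_eq_mul_div, div_mul_eq_mul_div, le_div_iff₀ hδ]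
  linarith

end LPJF

/-! ## From the synthesis inequality to a storage matrix -/

section Elimination

variable {n wd zd q b c : Type*} [Fintype n] [DecidableEq n] [Fintype wd] [Fintype zd]
  [Fintype q] [DecidableEq q] [Fintype b] [Fintype c]

/-- Elimination of the variable `p`, `β` from the analysis inequality. -/
theorem posDef_inv_sub_of_forall_pos {P₀ : Matrix n n ℝ} (hP₀ : P₀.PosDef) {B : Matrix n b ℝ}
    (hpos : ∀ (p : n → ℝ) (β : b → ℝ), p ≠ 0 →
      0 < p ⬝ᵥ P₀ *ᵥ p + 2 * (β ⬝ᵥ Bᵀ *ᵥ P₀ *ᵥ p) + β ⬝ᵥ β) :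
    (P₀⁻¹ - B * Bᵀ).PosDef := by
  have hdet := (Matrix.isUnit_iff_isUnit_det _).1 hP₀.isUnit
  refine .of_dotProduct_mulVec_pos ?_ fun v hv => ?_
  · simp [Matrix.IsHermitian, transpose_nonsing_inv, hP₀.transpose_eq]
  have e1 : P₀ *ᵥ P₀⁻¹ *ᵥ v = v := by
    rw [mulVec_mulVec, Matrix.mul_nonsing_inv _ hdet, one_mulVec]
  have hp : P₀⁻¹ *ᵥ v ≠ 0 := fun h0 => hv (by rw [← e1, h0, mulVec_zero])
  -- Minimizing over `β` gives `β = -Bᵀ P₀ p`; with `p = P₀⁻¹ v` the minimum is the form to be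
  -- bounded.
  have h1 := hpos (P₀⁻¹ *ᵥ v) (-(Bᵀ *ᵥ v)) hp
  rw [e1, dotProduct_comm _ v] at h1
  have e2 : v ⬝ᵥ B *ᵥ Bᵀ *ᵥ v = (Bᵀ *ᵥ v) ⬝ᵥ (Bᵀ *ᵥ v) := by
    rw [mulVec_dotProduct_eq Bᵀ, transpose_transpose]
  simp only [star_trivial, sub_mulVec, dotProduct_sub, ← mulVec_mulVec, e2]
  simp only [neg_dotProduct, dotProduct_neg] at h1
  linarith

/-- Elimination of all multipliers from the analysis inequality. -/
theorem jump_lt_of_forall_pos {P₀ : Matrix n n ℝ} (hP₀ : P₀.PosDef)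
    {A : Matrix n n ℝ} {B : Matrix n b ℝ} {C : Matrix c n ℝ}
    (hB : (P₀⁻¹ - B * Bᵀ).PosDef)
    {Qd : Matrix wd wd ℝ} {Sd : Matrix wd zd ℝ} {E : Matrix q zd ℝ} {W : Matrix q q ℝ}
    (hW : W.PosDef) {x y : n → ℝ} {d : wd → ℝ} {z : zd → ℝ}
    (hpos : ∀ (π : q → ℝ) (γ : c → ℝ) (p : n → ℝ) (β : b → ℝ),
      0 < x ⬝ᵥ P₀ *ᵥ x + d ⬝ᵥ Qd *ᵥ d + 2 * (d ⬝ᵥ Sd *ᵥ z) + 2 * (π ⬝ᵥ E *ᵥ z) + π ⬝ᵥ W *ᵥ π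
        + 2 * (γ ⬝ᵥ C *ᵥ y) + γ ⬝ᵥ γ + 2 * ((P₀ *ᵥ p) ⬝ᵥ A *ᵥ y) + p ⬝ᵥ P₀ *ᵥ p
        + 2 * (β ⬝ᵥ Bᵀ *ᵥ P₀ *ᵥ p) + β ⬝ᵥ β) :
    y ⬝ᵥ (Cᵀ * C + Aᵀ * (P₀⁻¹ - B * Bᵀ)⁻¹ * A) *ᵥ y
      < x ⬝ᵥ P₀ *ᵥ x + quadSupply Qd Sd (-(Eᵀ * W⁻¹ * E)) d z := by
  have hdet := (Matrix.isUnit_iff_isUnit_det _).1 hP₀.isUnit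
  have hdet' := (Matrix.isUnit_iff_isUnit_det _).1 hB.isUnit
  have hdetW := (Matrix.isUnit_iff_isUnit_det _).1 hW.isUnit
  set M := P₀⁻¹ - B * Bᵀ with hM
  set s := M⁻¹ *ᵥ A *ᵥ y with hs
  have e1 : P₀ *ᵥ P₀⁻¹ *ᵥ s = s := by
    rw [mulVec_mulVec, Matrix.mul_nonsing_inv _ hdet, one_mulVec]
  have e2 : s ⬝ᵥ B *ᵥ Bᵀ *ᵥ s = (Bᵀ *ᵥ s) ⬝ᵥ (Bᵀ *ᵥ s) := by
    rw [mulVec_dotProduct_eq Bᵀ, transpose_transpose]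
  have e3 : M *ᵥ s = A *ᵥ y := by
    rw [hs, mulVec_mulVec, Matrix.mul_nonsing_inv _ hdet', one_mulVec]
  have e4 : s ⬝ᵥ M *ᵥ s = s ⬝ᵥ P₀⁻¹ *ᵥ s - (Bᵀ *ᵥ s) ⬝ᵥ (Bᵀ *ᵥ s) := by
    rw [hM, sub_mulVec, dotProduct_sub, ← mulVec_mulVec, e2]
  have e5 : W *ᵥ W⁻¹ *ᵥ E *ᵥ z = E *ᵥ z := by
    rw [mulVec_mulVec, Matrix.mul_nonsing_inv _ hdetW, one_mulVec]
  -- These are the minimizing multipliers: `π = -W⁻¹ E z`, `γ = -C y`, `β = -Bᵀ P₀ p`, and then `P₀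
  -- p = -M⁻¹ A y = -s`. The minimum contains `-sᵀ M s`.
  have h1 := hpos (-(W⁻¹ *ᵥ E *ᵥ z)) (-(C *ᵥ y)) (-(P₀⁻¹ *ᵥ s)) (Bᵀ *ᵥ s)
  simp only [mulVec_neg, neg_dotProduct, dotProduct_neg, e1, e5, dotProduct_comm (P₀⁻¹ *ᵥ s) s,
    dotProduct_comm (W⁻¹ *ᵥ E *ᵥ z), ← e3] at h1
  have e6 : y ⬝ᵥ (Cᵀ * C + Aᵀ * M⁻¹ * A) *ᵥ y = (C *ᵥ y) ⬝ᵥ (C *ᵥ y) + s ⬝ᵥ M *ᵥ s := by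
    simp only [add_mulVec, dotProduct_add, ← mulVec_mulVec, ← mulVec_dotProduct_eq, e3]
    rw [← hs, dotProduct_comm (A *ᵥ y)]
  rw [e6, quadSupply_eq]
  simp only [neg_mulVec, dotProduct_neg, ← mulVec_mulVec, ← mulVec_dotProduct_eq]
  linarith

end Elimination

/-! ### Quadratic form of the synthesis matrix -/

section StarBlock

theorem starBlock_quadForm {m n : Type*} [Fintype m] [Fintype n] (A : Matrix m m ℝ)
    (B : Matrix n m ℝ) (D : Matrix n n ℝ) (v : m → ℝ) (w : n → ℝ) :
    Sum.elim v w ⬝ᵥ starBlock A B D *ᵥ Sum.elim v w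
      = v ⬝ᵥ A *ᵥ v + 2 * (w ⬝ᵥ B *ᵥ v) + w ⬝ᵥ D *ᵥ w := by
  have h1 : v ⬝ᵥ Bᵀ *ᵥ w = w ⬝ᵥ B *ᵥ v := by
    rw [dotProduct_comm, mulVec_dotProduct_eq, transpose_transpose]
  simp only [starBlock, fromBlocks_mulVec, Sum.elim_comp_inl, Sum.elim_comp_inr,
    sumElim_dotProduct_sumElim, dotProduct_add, h1]
  ring

end StarBlock

section Synthesis

variable {xp wc wd zc zd u y q b c : Type*} [Fintype xp] [DecidableEq xp] [Fintype wd]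
  [DecidableEq wd] [Fintype zd] [DecidableEq zd] [Fintype u] [DecidableEq u] [Fintype y]
  [DecidableEq y] [Fintype q] [DecidableEq q]
  [Fintype b] [DecidableEq b] [Fintype c] [DecidableEq c]
  {P : GenPlant xp wc wd zc zd u y}
  {Qd : Matrix wd wd ℝ} {Sd : Matrix wd zd ℝ} {Ed : Matrix q zd ℝ} {Pid : Matrix q q ℝ}
  {Abar : Matrix xp xp ℝ} {Bbar : Matrix xp b ℝ} {Cbar : Matrix c xp ℝ}
  {Γ : Matrix xp xp ℝ} {Θ : Matrix xp y ℝ} {Υ : Matrix u xp ℝ} {Ω : Matrix u y ℝ}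
  {X Y U V : Matrix xp xp ℝ}

/-- The form sees `a₁, a₂, d` off the diagonal only through three combinations: the jump output `z`,
the plant state `xj` after the jump, and `l`, which will be `Y Ā xj` plus `V` times the controller
state after the jump. They enter by equations so that closed-loop expressions can be inserted. -/
theorem synthesisMatrix_quadForm (a₁ a₂ : xp → ℝ) (d : wd → ℝ) (π : q → ℝ) (γ : c → ℝ)
    (p₁ p₂ : xp → ℝ) (β : b → ℝ) {z : zd → ℝ} {xj l : xp → ℝ}
    (hz : z = (P.Cd + P.Ddu * Ω * P.Cy) *ᵥ a₁ + (P.Cd * X + P.Ddu * Υ) *ᵥ a₂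
      + (P.Ddd + P.Ddu * Ω * P.Dyd) *ᵥ d)
    (hx : xj = (P.Ad + P.Bu * Ω * P.Cy) *ᵥ a₁ + (P.Ad * X + P.Bu * Υ) *ᵥ a₂
      + (P.Bd + P.Bu * Ω * P.Dyd) *ᵥ d)
    (hl : l = (Y * Abar * P.Ad + Θ * P.Cy) *ᵥ a₁ + Γ *ᵥ a₂
      + (Y * Abar * P.Bd + Θ * P.Dyd) *ᵥ d) :
    Sum.elim (Sum.elim (Sum.elim (Sum.elim (Sum.elim (Sum.elim (Sum.elim a₁ a₂) d) π) γ) p₁) p₂) β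
      ⬝ᵥ synthesisMatrix P Qd Sd Ed Pid Abar Bbar Cbar Γ Θ Υ Ω X Y *ᵥ
    Sum.elim (Sum.elim (Sum.elim (Sum.elim (Sum.elim (Sum.elim (Sum.elim a₁ a₂) d) π) γ) p₁) p₂) β
      = Sum.elim a₁ a₂ ⬝ᵥ starBlock Y 1 X *ᵥ Sum.elim a₁ a₂ + d ⬝ᵥ Qd *ᵥ d
        + 2 * (d ⬝ᵥ Sd *ᵥ z) + 2 * (π ⬝ᵥ Ed *ᵥ z) + π ⬝ᵥ Pid *ᵥ π
        + 2 * (γ ⬝ᵥ Cbar *ᵥ xj) + γ ⬝ᵥ γ + 2 * (p₁ ⬝ᵥ l + p₂ ⬝ᵥ Abar *ᵥ xj)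
        + Sum.elim p₁ p₂ ⬝ᵥ starBlock Y 1 X *ᵥ Sum.elim p₁ p₂
        + 2 * (β ⬝ᵥ Bbarᵀ *ᵥ (Y *ᵥ p₁ + p₂)) + β ⬝ᵥ β := by
  have h1 : ∀ D : Matrix wd wd ℝ, d ⬝ᵥ Dᵀ *ᵥ d = d ⬝ᵥ D *ᵥ d := fun D => by
    rw [dotProduct_comm, mulVec_dotProduct_eq, transpose_transpose]
  have hZ : d ⬝ᵥ (Qd + Sd * (P.Ddd + P.Ddu * Ω * P.Dyd)
      + (P.Ddd + P.Ddu * Ω * P.Dyd)ᵀ * Sdᵀ) *ᵥ d = d ⬝ᵥ Qd *ᵥ d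
        + 2 * (d ⬝ᵥ Sd *ᵥ (P.Ddd + P.Ddu * Ω * P.Dyd) *ᵥ d) := by
    rw [← transpose_mul, add_mulVec, add_mulVec, dotProduct_add, dotProduct_add, h1,
      ← mulVec_mulVec]
    ring
  subst hz hx hl
  simp only [synthesisMatrix, starBlock_quadForm, fromCols_mulVec_sumElim, hZ]
  generalize P.Cd + P.Ddu * Ω * P.Cy = Ωc
  generalize P.Cd * X + P.Ddu * Υ = K₂
  generalize P.Ddd + P.Ddu * Ω * P.Dyd = Ωd
  generalize P.Ad + P.Bu * Ω * P.Cy = Ωa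
  generalize P.Ad * X + P.Bu * Υ = K₁
  generalize P.Bd + P.Bu * Ω * P.Dyd = Ωb
  generalize Y * Abar * P.Ad + Θ * P.Cy = L₁
  generalize Y * Abar * P.Bd + Θ * P.Dyd = L₂
  simp only [zero_mulVec, one_mulVec, ← mulVec_mulVec, mulVec_add, dotProduct_add, dotProduct_zero]
  ring

theorem synthesisMatrix_posDef_starBlock
    (hLMI : (synthesisMatrix P Qd Sd Ed Pid Abar Bbar Cbar Γ Θ Υ Ω X Y).PosDef) :
    (starBlock Y 1 X).PosDef :=
  hLMI.submatrix (e := fun i => .inl (.inl (.inl (.inl (.inl (.inl i))))))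
    (fun i j hij => by simpa using hij)

theorem isUnit_one_sub_mul_of_starBlock_posDef (hYX : (starBlock Y 1 X).PosDef) :
    IsUnit (1 - X * Y) := by
  rw [← Matrix.mulVec_injective_iff_isUnit]
  refine (injective_iff_map_eq_zero (Matrix.mulVecLin (1 - X * Y))).2 fun v hv => ?_
  rw [mulVecLin_apply, sub_mulVec, one_mulVec, sub_eq_zero, ← mulVec_mulVec] at hv
  by_contra hv0
  -- If `v = X Y v`, then the form of `[Y I; I X]` vanishes at `(v, -Y v)`.
  have h1 := hYX.quadForm_pos (v := Sum.elim v (-(Y *ᵥ v))) fun h0 =>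
    hv0 (by simpa using congrArg (· ∘ Sum.inl) h0)
  simp only [starBlock_quadForm, mulVec_neg, ← hv, one_mulVec, dotProduct_neg,
    dotProduct_comm _ v] at h1
  linarith

/-- Put `P₀ = Π₂ Π₁⁻¹` with `Π₁ = [I X; 0 Uᵀ]` and `Π₂ = [Y I; Vᵀ 0]`. The relation `U Vᵀ = I - X Y`
makes `Π₁ᵀ Π₂ = [Y I; I X]`, so `P₀` is congruent to a positive definite matrix. -/
theorem exists_posDef_mul_eq (hYX : (starBlock Y 1 X).PosDef) (hU : IsUnit U)
    (hUV : U * Vᵀ = 1 - X * Y) :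
    ∃ P₀ : Matrix (xp ⊕ xp) (xp ⊕ xp) ℝ, P₀.PosDef ∧
      P₀ * fromBlocks 1 X 0 Uᵀ = fromBlocks Y 1 Vᵀ 0 := by
  have hX : Xᵀ = X := by
    have := hYX.transpose_eq
    rw [starBlock, fromBlocks_transpose, fromBlocks_inj] at this
    exact this.2.2.2
  have hunit : IsUnit (fromBlocks (1 : Matrix xp xp ℝ) X 0 Uᵀ) := by
    rw [Matrix.isUnit_fromBlocks_zero₂₁]
    exact ⟨isUnit_one, (Matrix.isUnit_transpose U).2 hU⟩
  have hdet := (Matrix.isUnit_iff_isUnit_det _).1 hunit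
  have hmul : (fromBlocks (1 : Matrix xp xp ℝ) X 0 Uᵀ)ᵀ * fromBlocks Y 1 Vᵀ 0 = starBlock Y 1 X := by
    simp [fromBlocks_transpose, fromBlocks_multiply, starBlock, hX, hUV]
  refine ⟨fromBlocks Y 1 Vᵀ 0 * (fromBlocks 1 X 0 Uᵀ)⁻¹, ?_, ?_⟩
  · have h1 := hYX.conjTranspose_mul_mul_same (B := (fromBlocks 1 X 0 Uᵀ)⁻¹)
      (Matrix.mulVec_injective_of_isUnit (Matrix.isUnit_nonsing_inv_iff.2 hunit))
    rw [conjTranspose_eq_transpose_of_trivial, ← hmul, transpose_nonsing_inv, ← mul_assoc,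
      Matrix.nonsing_inv_mul _ (by rwa [det_transpose]), one_mul] at h1
    exact h1
  · rw [mul_assoc, Matrix.nonsing_inv_mul _ hdet, mul_one]

theorem synthesisController_spec (hU : IsUnit U) (hV : IsUnit V) {K : DTController xp u y}
    (hK : K = synthesisController P Abar Γ Θ Υ Ω X Y U V) :
    V * K.A * Uᵀ + Y * Abar * P.Bu * K.C * Uᵀ + Θ * (P.Cy * X) = Γ - Y * Abar * P.Ad * X ∧
      V * K.B + Y * Abar * P.Bu * K.D = Θ ∧ K.C * Uᵀ + K.D * (P.Cy * X) = Υ ∧ K.D = Ω := by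
  set M := (fromBlocks V (Y * Abar * P.Bu) (0 : Matrix u xp ℝ) 1)⁻¹
      * fromBlocks (Γ - Y * Abar * P.Ad * X) Θ Υ Ω
      * (fromBlocks Uᵀ (0 : Matrix xp y ℝ) (P.Cy * X) 1)⁻¹ with hM
  have hKM : fromBlocks K.A K.B K.C K.D = M := by
    rw [hK]
    exact fromBlocks_toBlocks M
  have h1 : IsUnit (fromBlocks V (Y * Abar * P.Bu) (0 : Matrix u xp ℝ) (1 : Matrix u u ℝ)) :=
    Matrix.isUnit_fromBlocks_zero₂₁.2 ⟨hV, isUnit_one⟩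
  have h2 : IsUnit (fromBlocks Uᵀ (0 : Matrix xp y ℝ) (P.Cy * X) (1 : Matrix y y ℝ)) :=
    Matrix.isUnit_fromBlocks_zero₁₂.2 ⟨(Matrix.isUnit_transpose U).2 hU, isUnit_one⟩
  have h3 : fromBlocks V (Y * Abar * P.Bu) (0 : Matrix u xp ℝ) 1 * fromBlocks K.A K.B K.C K.D
      * fromBlocks Uᵀ (0 : Matrix xp y ℝ) (P.Cy * X) 1 = fromBlocks (Γ - Y * Abar * P.Ad * X) Θ Υ Ω := by
    rw [hKM, hM, ← Matrix.mul_assoc, ← Matrix.mul_assoc,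
      Matrix.mul_nonsing_inv _ ((Matrix.isUnit_iff_isUnit_det _).1 h1), Matrix.one_mul,
      Matrix.nonsing_inv_mul_cancel_right _ _ ((Matrix.isUnit_iff_isUnit_det _).1 h2)]
  simp only [fromBlocks_multiply, fromBlocks_inj, Matrix.zero_mul, Matrix.mul_zero, zero_add,
    Matrix.one_mul, Matrix.mul_one] at h3
  obtain ⟨e1, e2, e3, e4⟩ := h3
  refine ⟨?_, e2, e3, e4⟩
  rw [← e1, ← e2]
  simp only [Matrix.add_mul, Matrix.mul_assoc]

/-- The synthesis inequality yields a storage matrix for the closed loop with the synthesized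
controller, which satisfies the analysis inequality. -/
theorem exists_storage_of_synthesis
    (hLMI : (synthesisMatrix P Qd Sd Ed Pid Abar Bbar Cbar Γ Θ Υ Ω X Y).PosDef)
    (hPid : Pid.PosDef) (hU : IsUnit U) (hV : IsUnit V) (hUV : U * Vᵀ = 1 - X * Y)
    {T : LPJF (xp ⊕ xp) wc wd zc zd}
    (hT : T = P.closedLoop (synthesisController P Abar Γ Θ Υ Ω X Y U V)) :
    ∃ P₀ : Matrix (xp ⊕ xp) (xp ⊕ xp) ℝ, P₀.PosDef ∧
      (P₀⁻¹ - fromRows Bbar (0 : Matrix xp b ℝ) * (fromRows Bbar 0)ᵀ).PosDef ∧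
      ∀ x d, x ≠ 0 ∨ d ≠ 0 → (T.Ad *ᵥ x + T.Bd *ᵥ d) ⬝ᵥ
        ((fromCols Cbar (0 : Matrix c xp ℝ))ᵀ * fromCols Cbar 0 + (fromBlocks Abar 0 0 1)ᵀ
          * (P₀⁻¹ - fromRows Bbar (0 : Matrix xp b ℝ) * (fromRows Bbar 0)ᵀ)⁻¹
          * fromBlocks Abar 0 0 1) *ᵥ (T.Ad *ᵥ x + T.Bd *ᵥ d)
        < x ⬝ᵥ P₀ *ᵥ x
          + quadSupply Qd Sd (-(Edᵀ * Pid⁻¹ * Ed)) d (T.Cd *ᵥ x + T.Dd *ᵥ d) := by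
  have hYX := synthesisMatrix_posDef_starBlock hLMI
  obtain ⟨P₀, hP₀, hmul⟩ := exists_posDef_mul_eq hYX hU hUV
  obtain ⟨K, hK⟩ : ∃ K, K = synthesisController P Abar Γ Θ Υ Ω X Y U V := ⟨_, rfl⟩
  obtain ⟨e1, e2, e3, e4⟩ := synthesisController_spec hU hV hK
  rw [← hK] at hT
  obtain ⟨hY, -, -, hX⟩ : Yᵀ = Y ∧ _ ∧ _ ∧ Xᵀ = X := by
    have := hYX.transpose_eq
    rwa [starBlock, fromBlocks_transpose, fromBlocks_inj] at this
  have hΓ : Γ = V * K.A * Uᵀ + Y * Abar * P.Bu * K.C * Uᵀ + Θ * (P.Cy * X)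
      + Y * Abar * P.Ad * X := by rw [e1]; abel
  -- The congruence `x = Π₁ (a₁, a₂)` loses nothing because `U` is invertible.
  have hsurj : ∀ x : xp ⊕ xp → ℝ, ∃ a₁ a₂ : xp → ℝ,
      x = Sum.elim (a₁ + X *ᵥ a₂) (Uᵀ *ᵥ a₂) := by
    intro x
    have hdet : IsUnit Uᵀ.det := (Matrix.isUnit_iff_isUnit_det _).1 ((Matrix.isUnit_transpose U).2 hU)
    refine ⟨x ∘ Sum.inl - X *ᵥ Uᵀ⁻¹ *ᵥ (x ∘ Sum.inr), Uᵀ⁻¹ *ᵥ (x ∘ Sum.inr), ?_⟩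
    rw [sub_add_cancel, mulVec_mulVec, Matrix.mul_nonsing_inv _ hdet, one_mulVec,
      Sum.elim_comp_inl_inr]
  have hP₀mul : ∀ a₁ a₂ : xp → ℝ, P₀ *ᵥ Sum.elim (a₁ + X *ᵥ a₂) (Uᵀ *ᵥ a₂)
      = Sum.elim (Y *ᵥ a₁ + a₂) (Vᵀ *ᵥ a₁) := fun a₁ a₂ => by
    have := congrArg (· *ᵥ Sum.elim a₁ a₂) hmul
    simpa [← mulVec_mulVec, fromBlocks_mulVec, Sum.elim_comp_inl, Sum.elim_comp_inr] using this
  have hform : ∀ a₁ a₂ : xp → ℝ, Sum.elim (a₁ + X *ᵥ a₂) (Uᵀ *ᵥ a₂) ⬝ᵥ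
      P₀ *ᵥ Sum.elim (a₁ + X *ᵥ a₂) (Uᵀ *ᵥ a₂)
        = Sum.elim a₁ a₂ ⬝ᵥ starBlock Y 1 X *ᵥ Sum.elim a₁ a₂ := fun a₁ a₂ => by
    have h1 : (Uᵀ *ᵥ a₂) ⬝ᵥ (Vᵀ *ᵥ a₁) = a₂ ⬝ᵥ a₁ - (X *ᵥ a₂) ⬝ᵥ (Y *ᵥ a₁) := by
      rw [mulVec_dotProduct_eq, mulVec_dotProduct_eq, transpose_transpose, mulVec_mulVec, hUV, hX,
        sub_mulVec, one_mulVec, dotProduct_sub, mulVec_mulVec]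
    rw [hP₀mul, starBlock_quadForm, sumElim_dotProduct_sumElim, h1]
    simp only [add_dotProduct, dotProduct_add, one_mulVec, dotProduct_comm (X *ᵥ a₂) a₂,
      dotProduct_comm a₁ a₂]
    ring
  have hjump : ∀ (a₁ a₂ : xp → ℝ) (d : wd → ℝ),
      T.Ad *ᵥ Sum.elim (a₁ + X *ᵥ a₂) (Uᵀ *ᵥ a₂) + T.Bd *ᵥ d = Sum.elim
        ((P.Ad + P.Bu * Ω * P.Cy) *ᵥ a₁ + (P.Ad * X + P.Bu * Υ) *ᵥ a₂
          + (P.Bd + P.Bu * Ω * P.Dyd) *ᵥ d)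
        (K.B *ᵥ P.Cy *ᵥ (a₁ + X *ᵥ a₂) + K.A *ᵥ Uᵀ *ᵥ a₂ + K.B *ᵥ P.Dyd *ᵥ d) := by
    intro a₁ a₂ d
    have hadd : ∀ f f' g g' : xp → ℝ,
        Sum.elim f g + Sum.elim f' g' = Sum.elim (f + f') (g + g') := fun f f' g g' => by
      ext (i | i) <;> rfl
    rw [← e3, ← e4, hT]
    simp only [GenPlant.closedLoop, fromBlocks_mulVec, fromRows_mulVec, Sum.elim_comp_inl,
      Sum.elim_comp_inr, hadd]
    congr 1
    · simp only [add_mulVec, mulVec_add, Matrix.mul_add, ← mulVec_mulVec]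
      abel
    · simp only [mulVec_add, ← mulVec_mulVec]
  have hout : ∀ (a₁ a₂ : xp → ℝ) (d : wd → ℝ),
      T.Cd *ᵥ Sum.elim (a₁ + X *ᵥ a₂) (Uᵀ *ᵥ a₂) + T.Dd *ᵥ d =
        (P.Cd + P.Ddu * Ω * P.Cy) *ᵥ a₁ + (P.Cd * X + P.Ddu * Υ) *ᵥ a₂
          + (P.Ddd + P.Ddu * Ω * P.Dyd) *ᵥ d := by
    intro a₁ a₂ d
    rw [← e3, ← e4, hT]
    simp only [GenPlant.closedLoop, fromCols_mulVec_sumElim]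
    simp only [add_mulVec, mulVec_add, Matrix.mul_add, ← mulVec_mulVec]
    abel
  -- This is where the linearizing change of variables acts: the products of the controller matrices
  -- with `Y, V, X, U` collapse into `Γ` and `Θ`.
  have hstate : ∀ (a₁ a₂ : xp → ℝ) (d : wd → ℝ),
      (Y * Abar) *ᵥ ((P.Ad + P.Bu * Ω * P.Cy) *ᵥ a₁ + (P.Ad * X + P.Bu * Υ) *ᵥ a₂
          + (P.Bd + P.Bu * Ω * P.Dyd) *ᵥ d)
        + V *ᵥ (K.B *ᵥ P.Cy *ᵥ (a₁ + X *ᵥ a₂) + K.A *ᵥ Uᵀ *ᵥ a₂ + K.B *ᵥ P.Dyd *ᵥ d)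
      = (Y * Abar * P.Ad + Θ * P.Cy) *ᵥ a₁ + Γ *ᵥ a₂ + (Y * Abar * P.Bd + Θ * P.Dyd) *ᵥ d := by
    intro a₁ a₂ d
    rw [hΓ, ← e3, ← e2, ← e4]
    simp only [add_mulVec, mulVec_add, Matrix.mul_add, ← mulVec_mulVec]
    abel
  -- By `hP₀mul`, the vector `P₀ p` is `(Y p₁ + p₂, Vᵀ p₁)`; its pairing with the propagated
  -- post-jump state is the one occurring in the LMI.
  have hdual : ∀ p₁ p₂ s r : xp → ℝ, (Y *ᵥ p₁ + p₂) ⬝ᵥ Abar *ᵥ s + Vᵀ *ᵥ p₁ ⬝ᵥ r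
      = p₁ ⬝ᵥ ((Y * Abar) *ᵥ s + V *ᵥ r) + p₂ ⬝ᵥ Abar *ᵥ s := fun p₁ p₂ s r => by
    rw [add_dotProduct, dotProduct_add, mulVec_dotProduct_eq Y, mulVec_dotProduct_eq Vᵀ, hY,
      transpose_transpose, mulVec_mulVec]
    ring
  -- The analysis inequality, which is the LMI form evaluated at the transformed vector.
  have hpos : ∀ (x : xp ⊕ xp → ℝ) (d : wd → ℝ) (π : q → ℝ) (γ : c → ℝ) (p : xp ⊕ xp → ℝ)
      (β : b → ℝ), x ≠ 0 ∨ d ≠ 0 ∨ p ≠ 0 →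
      0 < x ⬝ᵥ P₀ *ᵥ x + d ⬝ᵥ Qd *ᵥ d + 2 * (d ⬝ᵥ Sd *ᵥ (T.Cd *ᵥ x + T.Dd *ᵥ d))
        + 2 * (π ⬝ᵥ Ed *ᵥ (T.Cd *ᵥ x + T.Dd *ᵥ d)) + π ⬝ᵥ Pid *ᵥ π
        + 2 * (γ ⬝ᵥ fromCols Cbar 0 *ᵥ (T.Ad *ᵥ x + T.Bd *ᵥ d)) + γ ⬝ᵥ γ
        + 2 * ((P₀ *ᵥ p) ⬝ᵥ fromBlocks Abar 0 0 1 *ᵥ (T.Ad *ᵥ x + T.Bd *ᵥ d)) + p ⬝ᵥ P₀ *ᵥ p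
        + 2 * (β ⬝ᵥ (fromRows Bbar (0 : Matrix xp b ℝ))ᵀ *ᵥ P₀ *ᵥ p) + β ⬝ᵥ β := by
    intro x d π γ p β hne
    obtain ⟨a₁, a₂, rfl⟩ := hsurj x
    obtain ⟨p₁, p₂, rfl⟩ := hsurj p
    have hq := synthesisMatrix_quadForm (P := P) (Qd := Qd) (Sd := Sd) (Ed := Ed) (Pid := Pid)
      (Abar := Abar) (Bbar := Bbar) (Cbar := Cbar) (Γ := Γ) (Θ := Θ) (Υ := Υ) (Ω := Ω)
      (X := X) (Y := Y) a₁ a₂ d π γ p₁ p₂ β (hout a₁ a₂ d) rfl (hstate a₁ a₂ d)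
    have hv := hLMI.quadForm_pos (v := Sum.elim (Sum.elim (Sum.elim (Sum.elim (Sum.elim
      (Sum.elim (Sum.elim a₁ a₂) d) π) γ) p₁) p₂) β) (fun h0 => by
        have ha₁ : a₁ = 0 := funext fun i => congrFun h0 (.inl (.inl (.inl (.inl (.inl (.inl (.inl i)))))))
        have ha₂ : a₂ = 0 := funext fun i => congrFun h0 (.inl (.inl (.inl (.inl (.inl (.inl (.inr i)))))))
        have hd : d = 0 := funext fun i => congrFun h0 (.inl (.inl (.inl (.inl (.inl (.inr i))))))
        have hp₁ : p₁ = 0 := funext fun i => congrFun h0 (.inl (.inl (.inr i)))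
        have hp₂ : p₂ = 0 := funext fun i => congrFun h0 (.inl (.inr i))
        simp [ha₁, ha₂, hd, hp₁, hp₂] at hne)
    rw [hq] at hv
    rw [hform, hform, hP₀mul, hjump]
    simp only [transpose_fromRows, fromCols_mulVec_sumElim, fromBlocks_mulVec, Sum.elim_comp_inl,
      Sum.elim_comp_inr, transpose_zero, zero_mulVec, add_zero, zero_add, one_mulVec,
      sumElim_dotProduct_sumElim]
    rw [hdual]
    exact hv
  have hB := posDef_inv_sub_of_forall_pos hP₀ (B := fromRows Bbar (0 : Matrix xp b ℝ))
    fun p β hp => by simpa using hpos 0 0 0 0 p β (.inr (.inr hp))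
  refine ⟨P₀, hP₀, hB, fun x d hxd => jump_lt_of_forall_pos hP₀ hB hPid fun π γ p β =>
    hpos x d π γ p β (hxd.imp_right .inl)⟩

end Synthesis

/-! ### The controller state under the Hamiltonian flow -/

section ClosedLoopFlow

variable {xp xc wc wd zc zd u y : Type*} [Fintype xp] [DecidableEq xp] [Fintype xc]
  [DecidableEq xc] [Fintype wc] [DecidableEq wc] [Fintype zc]
  {P : GenPlant xp wc wd zc zd u y}
  {Q : Matrix wc wc ℝ} {S : Matrix wc zc ℝ} {R : Matrix zc zc ℝ}

/-- As the controller state is constant during flow, the inverse of `F₁₁` acts trivially on it. -/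
theorem GenPlant.invTransition_closedLoopFlow {T : FlowSystem (xp ⊕ xc) wc zc}
    (hT : T = P.closedLoopFlow xc) {τ : ℝ} (hu : IsUnit (T.F₁₁ Q S R τ)) :
    (T.F₁₁ Q S R τ)⁻¹ = fromBlocks (T.F₁₁ Q S R τ)⁻¹.toBlocks₁₁ 0 0 1 := by
  have hdet := (Matrix.isUnit_iff_isUnit_det _).1 hu
  -- The projection onto the controller state. The matrix `diag(e, 0)` is annihilated by `H` from
  -- both sides, so it is fixed by `exp (-τ H)`; hence `F₁₁ e = e = e F₁₁`, and the same holds for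
  -- `F₁₁⁻¹`.
  set e : Matrix (xp ⊕ xc) (xp ⊕ xc) ℝ := fromBlocks 0 0 0 1 with he
  have hCe : T.Cc * e = 0 := by
    simp [hT, closedLoopFlow, he, fromCols_mul_fromBlocks]
  have heB : e * T.Bc = 0 := by
    simp [hT, closedLoopFlow, he, fromBlocks_mul_fromRows]
  have hAe : T.Ac * e = 0 := by
    simp [hT, closedLoopFlow, he, fromBlocks_multiply]
  have heA : e * T.Ac = 0 := by
    simp [hT, closedLoopFlow, he, fromBlocks_multiply]
  have het : eᵀ = e := by simp [he, fromBlocks_transpose]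
  have hM₃ : (T.M₃ S R)ᵀ * e = 0 := by
    simp [FlowSystem.M₃, Matrix.mul_assoc, Matrix.add_mul, hCe]
  have hde : T.riccatiDrift Q S R * e = 0 := by
    rw [FlowSystem.riccatiDrift, Matrix.sub_mul, Matrix.mul_assoc, hM₃, hAe, Matrix.mul_zero, sub_zero]
  have hed : e * T.riccatiDrift Q S R = 0 := by
    rw [FlowSystem.riccatiDrift, Matrix.mul_sub, Matrix.mul_assoc, ← Matrix.mul_assoc e, heB, heA,
      Matrix.zero_mul, sub_zero]
  have heG : e * T.riccatiGain Q S R = 0 := by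
    rw [FlowSystem.riccatiGain, Matrix.mul_assoc, ← Matrix.mul_assoc e, heB, Matrix.zero_mul]
  have hNe : T.riccatiCost Q S R * e = 0 := by
    rw [FlowSystem.riccatiCost, Matrix.sub_mul, Matrix.mul_assoc, hM₃, FlowSystem.M₁,
      Matrix.mul_assoc, hCe, Matrix.mul_zero, Matrix.mul_zero, sub_zero]
  have h1 := hamExp_mul_of_hamMatrix_mul_eq_zero (T.riccatiDrift Q S R) (T.riccatiGain Q S R)
    (T.riccatiCost Q S R) (E := fromBlocks e 0 0 0)
    (by simp [hamMatrix, fromBlocks_multiply, hde, hNe]) τ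
  have h2 := mul_hamExp_of_mul_hamMatrix_eq_zero (T.riccatiDrift Q S R) (T.riccatiGain Q S R)
    (T.riccatiCost Q S R) (E := fromBlocks e 0 0 0)
    (by simp [hamMatrix, fromBlocks_multiply, hed, heG]) τ
  rw [← FlowSystem.F_eq_hamExp, ← fromBlocks_toBlocks (T.F Q S R τ), fromBlocks_multiply,
    fromBlocks_inj] at h1 h2
  have h3 : T.F₁₁ Q S R τ * e = e := by simpa [FlowSystem.F₁₁] using h1.1
  have h4 : e * T.F₁₁ Q S R τ = e := by simpa [FlowSystem.F₁₁] using h2.1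
  have h5 : (T.F₁₁ Q S R τ)⁻¹ * e = e := by
    conv_lhs => rw [← h3, ← Matrix.mul_assoc, Matrix.nonsing_inv_mul _ hdet, Matrix.one_mul]
  have h6 : e * (T.F₁₁ Q S R τ)⁻¹ = e := by
    conv_lhs => rw [← h4, Matrix.mul_assoc, Matrix.mul_nonsing_inv _ hdet, Matrix.mul_one]
  generalize (T.F₁₁ Q S R τ)⁻¹ = M at h5 h6 ⊢
  rw [← fromBlocks_toBlocks M, he, fromBlocks_multiply, fromBlocks_inj] at h5 h6
  simp only [Matrix.mul_zero, Matrix.zero_mul, Matrix.mul_one, Matrix.one_mul, zero_add] at h5 h6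
  conv_lhs => rw [← fromBlocks_toBlocks M, h5.2.1, h5.2.2.2, h6.2.2.1]

end ClosedLoopFlow

/-! ### Assembly of the theorem -/

theorem theorem3p2 {x xh wc wd zc zd u y q b c : Type*}
    [Fintype x] [DecidableEq x] [Fintype xh] [DecidableEq xh]
    [Fintype wc] [DecidableEq wc] [Fintype wd] [DecidableEq wd]
    [Fintype zc] [DecidableEq zc] [Fintype zd] [DecidableEq zd]
    [Fintype u] [DecidableEq u] [Fintype y] [DecidableEq y]
    [Fintype q] [DecidableEq q] [Fintype b] [DecidableEq b] [Fintype c] [DecidableEq c]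
    -- sampling period, plant and hold device
    (h : ℝ) (hh : 0 < h)
    (plant : SDPlant x wc wd zc zd u y) (hold : HoldDevice xh u)
    -- supply functions
    (Qc : Matrix wc wc ℝ) (Sc : Matrix wc zc ℝ) (Rc : Matrix zc zc ℝ)
    (Qd : Matrix wd wd ℝ) (Sd : Matrix wd zd ℝ) (Rd : Matrix zd zd ℝ)
    (Ed : Matrix q zd ℝ) (Pid : Matrix q q ℝ)
    (hRc : (-Rc).PosSemidef) (hPid : Pid.PosDef) (hRd : Rd = -(Edᵀ * Pid⁻¹ * Ed))
    -- the combined plant, with state dimension equal to that of the controller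
    (P : GenPlant (x ⊕ xh) wc wd zc zd u y) (hP : P = plant.withHold hold)
    (T : FlowSystem ((x ⊕ xh) ⊕ (x ⊕ xh)) wc zc) (hT : T = P.closedLoopFlow (x ⊕ xh))
    (hM₂ : (T.M₂ Qc Sc Rc).PosDef)
    (hF₁₁ : ∀ t ∈ Set.Icc 0 h, IsUnit (T.F₁₁ Qc Sc Rc t))
    (Abar : Matrix (x ⊕ xh) (x ⊕ xh) ℝ) (hAbar : Abar = (T.F₁₁ Qc Sc Rc h)⁻¹.toBlocks₁₁)
    (Bbar : Matrix (x ⊕ xh) b ℝ)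
    (hBbar : fromRows Bbar (0 : Matrix (x ⊕ xh) b ℝ) * (fromRows Bbar 0)ᵀ
      = -((T.F₁₁ Qc Sc Rc h)⁻¹ * T.F₁₂ Qc Sc Rc h))
    (Cbar : Matrix c (x ⊕ xh) ℝ)
    (hCbar : (fromCols Cbar (0 : Matrix c (x ⊕ xh) ℝ))ᵀ * fromCols Cbar 0
      = T.F₂₁ Qc Sc Rc h * (T.F₁₁ Qc Sc Rc h)⁻¹)
    -- feasibility of the synthesis LMI
    (Γ : Matrix (x ⊕ xh) (x ⊕ xh) ℝ) (Θ : Matrix (x ⊕ xh) y ℝ)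
    (Υ : Matrix u (x ⊕ xh) ℝ) (Ω : Matrix u y ℝ) (X Y : Matrix (x ⊕ xh) (x ⊕ xh) ℝ)
    (hLMI : (synthesisMatrix P Qd Sd Ed Pid Abar Bbar Cbar Γ Θ Υ Ω X Y).PosDef) :
    (∃ U V : Matrix (x ⊕ xh) (x ⊕ xh) ℝ, IsUnit U ∧ IsUnit V ∧ U * Vᵀ = 1 - X * Y) ∧
    ∀ U V : Matrix (x ⊕ xh) (x ⊕ xh) ℝ, IsUnit U → IsUnit V → U * Vᵀ = 1 - X * Y →
      (P.closedLoop (synthesisController P Abar Γ Θ Υ Ω X Y U V)).IsDissipative h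
        (quadSupply Qc Sc Rc) (quadSupply Qd Sd Rd) ∧
      (P.closedLoop (synthesisController P Abar Γ Θ Υ Ω X Y U V)).IsGES h := by
  refine ⟨⟨1 - X * Y, 1, isUnit_one_sub_mul_of_starBlock_posDef
    (synthesisMatrix_posDef_starBlock hLMI), isUnit_one, by rw [transpose_one, mul_one]⟩,
    fun U V hU hV hUV => ?_⟩
  obtain ⟨L, hL⟩ : ∃ L, L = P.closedLoop (synthesisController P Abar Γ Θ Υ Ω X Y U V) := ⟨_, rfl⟩
  obtain ⟨P₀, hP₀, hadm, hjump⟩ := exists_storage_of_synthesis hLMI hPid hU hV hUV hL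
  -- The flow part does not involve the controller matrices, so the Hamiltonian fixed in advance is
  -- that of the closed loop.
  have hLT : L.toFlowSystem = T := by rw [hL, hT]; rfl
  rw [← hL]
  have hhmem : h ∈ Icc 0 h := ⟨hh.le, le_rfl⟩
  -- After these substitutions the matrix in `hjump` is, by definition, the Riccati solution at `τ =
  -- h` started from `P₀`, and `hadm` becomes the admissibility of `P₀⁻¹`.
  rw [hCbar, hBbar, hAbar, ← P.invTransition_closedLoopFlow hT (hF₁₁ h hhmem)] at hjump
  rw [hBbar] at hadm
  rw [← hRd] at hjump
  subst hLT
  have hinv : P₀⁻¹⁻¹ = P₀ :=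
    Matrix.nonsing_inv_nonsing_inv _ ((Matrix.isUnit_iff_isUnit_det _).1 hP₀.isUnit)
  have hP : L.Admissible Qc Sc Rc P₀⁻¹ h := hadm
  have hRd' : (-Rd).PosSemidef := by
    rw [hRd, neg_neg]
    simpa using hPid.inv.posSemidef.conjTranspose_mul_mul_same Ed
  refine ⟨LPJF.isDissipative_of_storage hh hRc hM₂ hF₁₁ hP fun x d => ?_,
    LPJF.isGES_of_storage (zd := zd) hh hRc hM₂ hF₁₁ hP₀.inv hP fun x hx => ?_⟩
  · rw [hinv]
    -- The strict inequality excludes the zero vector, where both sides vanish.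
    by_cases hxd : x ≠ 0 ∨ d ≠ 0
    · exact (hjump x d hxd).le
    · push Not at hxd
      simp [hxd.1, hxd.2, quadSupply_eq]
  · rw [hinv]
    have h1 := hjump x 0 (.inl hx)
    have h2 := LPJF.quadSupply_zero_left_nonpos (Q := Qd) (S := Sd) hRd'
      (L.Cd *ᵥ x + L.Dd *ᵥ (0 : wd → ℝ))
    rw [mulVec_zero, add_zero] at h1
    exact h1.trans_le (by linarith)
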